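/- Let $d\in\{2,3\}$. A patch is $\Omega^{(k)}=G^{(k)}((0,1)^d)\subset\mathbb R^d$, where $G^{(k)}$ is a linear combination, with control points in $\mathbb R^d$, of the tensor product B-splines $N^{(k)}_i$ belonging to open knot vectors on $[0,1]$ (one for each direction, each with its own degree $\ge 1$, the end knots having multiplicity degree $+1$ and the interior knots multiplicity at most the degree); $G^{(k)}$ is one-to-one on $[0,1]^d$ and $\Omega^{(k)}$ is open. Let $H^{(k)}$ be the diameter of $\Omega^{(k)}$, let $h^{(k)}$ be the largest diameter of an image under $G^{(k)}$ of a cell of the knot mesh, and $h^{(kl)}=2h^{(k)}h^{(l)}/(h^{(k)}+h^{(l)})$. A multipatch domain consists of $N$ pairwise disjoint patches, $\overline\Omega=\bigcup_{k=1}^N\overline\Omega^{(k)}$, together with a Dirichlet boundary $\Gamma_D\subset\partial\Omega$ that is a union of complete patch sides. For $l\neq k$ put $F^{(kl)}=\overline\Omega^{(k)}\cap\overline\Omega^{(l)}$, and let $\mathcal I^{(k)}_{\mathcal F}$ be the set of those $l\ne k$ for which $F^{(kl)}$ is an edge ($d=2$) or face ($d=3$), i.e. has positive $(d-1)$-dimensional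 measure. The space $V_{D,h}$ consists of the families $u=(u^{(k)})_{k=1}^N$ with $u^{(k)}\in\operatorname{span}\{N^{(k)}_i\circ (G^{(k)})^{-1}\}$ such that $u^{(k)}=0$ on the sides of $\Omega^{(k)}$ that belong to $\Gamma_D$. Given constants $\alpha^{(k)}>0$ and $\delta>0$, and with $\partial u^{(k)}/\partial n$ the derivative (taken from within $\Omega^{(k)}$) in the direction of the outer normal of $\Omega^{(k)}$, let \begin{align*} a^{(k)}(u,v)&=\int_{\Omega^{(k)}}\alpha^{(k)}\nabla u^{(k)}\cdot\nabla v^{(k)}\,dx,\\ s^{(k)}(u,v)&=\sum_{l\in\mathcal I^{(k)}_{\mathcal F}}\int_{F^{(kl)}}\frac{\alpha^{(k)}}2\Big(\frac{\partial u^{(k)}}{\partial n}(v^{(l)}-v^{(k)})+\frac{\partial v^{(k)}}{\partial n}(u^{(l)}-u^{(k)})\Big)ds,\\ p^{(k)}(u,v)&=\sum_{l\in\mathcal I^{(k)}_{\mathcal F}}\int_{F^{(kl)}}\frac{\delta\alpha^{(k)}}{2h^{(kl)}}(u^{(l)}-u^{(k)})(v^{(l)}-v^{(k)})\,ds, \end{align*}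 $a_e^{(k)}=a^{(k)}+s^{(k)}+p^{(k)}$, $a_h=\sum_{k}a_e^{(k)}$, $d^{(k)}=a^{(k)}+p^{(k)}$, and $$\|u\|_{dG}^2=\sum_{k=1}^N\Big[\alpha^{(k)}\|\nabla u^{(k)}\|_{L^2(\Omega^{(k)})}^2+\sum_{l\in\mathcal I^{(k)}_{\mathcal F}}\frac{\delta\alpha^{(k)}}{h^{(kl)}}\int_{F^{(kl)}}(u^{(k)}-u^{(l)})^2ds\Big].$$ **Lemma.** Let $d\in\{2,3\}$, $p\in\mathbb N$ and $\kappa,\theta\ge1$. There are positive constants $\delta_0,\gamma_0,\gamma_1$, depending only on $d,p,\kappa,\theta$, with the following property. For every multipatch domain as above all of whose degrees are at most $p$, whose geometrical mappings satisfy $\kappa^{-1}H^{(k)}|\xi-\eta|\le|G^{(k)}(\xi)-G^{(k)}(\eta)|\le\kappa H^{(k)}|\xi-\eta|$ for $\xi,\eta\in[0,1]^d$, and whose meshes are quasi-uniform (on each patch, no knot span in any direction is longer than $\theta$ times any nonempty knot span in any direction), for all constants $\alpha^{(k)}>0$, all $\delta\ge\delta_0$ and all $u_h\in V_{D,h}$: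 $$\gamma_0\,d^{(k)}(u_h,u_h)\le a_e^{(k)}(u_h,u_h)\le\gamma_1\,d^{(k)}(u_h,u_h)\qquad(k=1,\dots,N),$$ and these inequalities also hold with $d^{(k)}$ replaced by $a_e^{(k)}+p^{(k)}$. Furthermore $$\gamma_0\|u_h\|_{dG}^2\le a_h(u_h,u_h)\le\gamma_1\|u_h\|_{dG}^2 .$$ In particular $\delta_0$, $\gamma_0$ and $\gamma_1$ do not depend on $N$, $h^{(k)}$, $H^{(k)}$, $\alpha^{(k)}$ or $u_h$, and $\gamma_0$, $\gamma_1$ do not depend on $\delta$. -/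

import Mathlib

open MeasureTheory Set Filter Topology
open scoped Gradient InnerProductSpace

namespace IgA

/-- Euclidean `d`-space. -/
abbrev E (d : ℕ) : Type := EuclideanSpace ℝ (Fin d)

/-! ### B-splines -/

/-- An open knot vector on `[0,1]` of degree `deg ≥ 1` carrying `num` B-splines. With indices
starting at `0`, the knots are `knot 0 ≤ ... ≤ knot (num + deg)` (the values beyond the last index
are irrelevant and set to `1`); the end knots `0` and `1` have multiplicity exactly `deg + 1` and
every interior knot has multiplicity at most `deg`, so that the splines are continuous. -/
structure KnotVector where
  deg : ℕ
  one_le_deg : 1 ≤ deg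
  num : ℕ
  knot : ℕ → ℝ
  mono : Monotone knot
  knot_left : ∀ i, i ≤ deg → knot i = 0
  knot_right : ∀ i, num ≤ i → knot i = 1
  mult_le : ∀ i, 1 ≤ i → i < num → knot i < knot (i + deg)

/-- The Cox-de Boor recursion: `bspline t p i` is the `i`-th B-spline of degree `p` for the knots
`t`. Quotients `0 / 0` count as `0`; the knot spans are half open, except that the last nonempty
one contains the end point `1`. -/
noncomputable def bspline (t : ℕ → ℝ) : ℕ → ℕ → ℝ → ℝ
  | 0, i, x =>
      open Classical in
      if (t i ≤ x ∧ x < t (i + 1)) ∨ (t i < t (i + 1) ∧ t (i + 1) = 1 ∧ x = 1) then 1 else 0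
  | p + 1, i, x =>
      (x - t i) / (t (i + p + 1) - t i) * bspline t p i x
        + (t (i + p + 2) - x) / (t (i + p + 2) - t (i + 1)) * bspline t p (i + 1) x

/-- The open parameter domain `(0,1)^d`. -/
def openCube (d : ℕ) : Set (E d) := {ξ | ∀ ι, ξ ι ∈ Ioo (0 : ℝ) 1}

/-- The closed parameter domain `[0,1]^d`. -/
def cube (d : ℕ) : Set (E d) := {ξ | ∀ ι, ξ ι ∈ Icc (0 : ℝ) 1}

/-- The sides of the parameter domain: `ξ_ι = 1` if `b` is true, `ξ_ι = 0` if it is false. -/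
def cubeSide (d : ℕ) (ι : Fin d) (b : Bool) : Set (E d) :=
  {ξ | ξ ∈ cube d ∧ ξ ι = if b then 1 else 0}

/-- Tensor product B-splines. -/
noncomputable def tensorBSpline {d : ℕ} (Ξ : Fin d → KnotVector) (i : ∀ ι, Fin (Ξ ι).num)
    (ξ : E d) : ℝ :=
  ∏ ι, bspline (Ξ ι).knot (Ξ ι).deg (i ι) (ξ ι)

/-- The geometrical mapping with control points `P`. -/
noncomputable def geoMap {d : ℕ} (Ξ : Fin d → KnotVector) (P : (∀ ι, Fin (Ξ ι).num) → E d)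
    (ξ : E d) : E d :=
  ∑ i, tensorBSpline Ξ i ξ • P i

/-! ### Patches -/

/-- A patch: knot vectors and control points whose geometrical mapping is one-to-one on the closed
parameter domain and maps the open parameter domain onto an open set. -/
structure Patch (d : ℕ) where
  Ξ : Fin d → KnotVector
  P : (∀ ι, Fin (Ξ ι).num) → E d
  injOn : InjOn (geoMap Ξ P) (cube d)
  isOpen_image : IsOpen (geoMap Ξ P '' openCube d)

namespace Patch

variable {d : ℕ} (K : Patch d)

/-- The geometrical mapping of the patch. -/
noncomputable def G : E d → E d := geoMap K.Ξ K.P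

/-- The (open) patch `G((0,1)^d)`. -/
def dom : Set (E d) := K.G '' openCube d

/-- The closed patch `G([0,1]^d)`. -/
def closedDom : Set (E d) := K.G '' cube d

/-- The sides (edges for `d = 2`, faces for `d = 3`) of the patch. -/
def side (ι : Fin d) (b : Bool) : Set (E d) := K.G '' cubeSide d ι b

/-- The patch diameter `H`. -/
noncomputable def diam : ℝ := Metric.diam K.closedDom

/-- The closed cells of the parameter mesh. Some may have empty interior; those are contained in
cells with nonempty interior. -/
def cell (j : ∀ ι, Fin ((K.Ξ ι).num + (K.Ξ ι).deg)) : Set (E d) :=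
  {ξ | ∀ ι, ξ ι ∈ Icc ((K.Ξ ι).knot (j ι)) ((K.Ξ ι).knot ((j ι : ℕ) + 1))}

/-- The mesh size `h`: the largest diameter of a cell of the physical mesh. -/
noncomputable def meshSize : ℝ :=
  ⨆ j : ∀ ι, Fin ((K.Ξ ι).num + (K.Ξ ι).deg), Metric.diam (K.G '' K.cell j)

/-- The physical B-spline basis functions `N_i ∘ G⁻¹` on the closed patch (set to `0` elsewhere). -/
noncomputable def basisFun (i : ∀ ι, Fin (K.Ξ ι).num) : E d → ℝ :=
  K.closedDom.indicator fun x => tensorBSpline K.Ξ i (Function.invFunOn K.G (cube d) x)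

/-- The discrete space of the patch. -/
noncomputable def space : Submodule ℝ (E d → ℝ) := Submodule.span ℝ (range K.basisFun)

/-- The geometrical mapping is, up to the scaling by the patch diameter `H`, bi-Lipschitz with
constant `κ`. -/
def IsShapeRegular (κ : ℝ) : Prop :=
  ∀ ξ ∈ cube d, ∀ η ∈ cube d,
    κ⁻¹ * K.diam * ‖ξ - η‖ ≤ ‖K.G ξ - K.G η‖ ∧ ‖K.G ξ - K.G η‖ ≤ κ * K.diam * ‖ξ - η‖

/-- The parameter mesh is quasi-uniform with constant `θ`: no knot span, in any direction, is
longer than `θ` times a nonempty knot span, in any direction. -/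
def IsQuasiUniform (θ : ℝ) : Prop :=
  ∀ (ι ι' : Fin d) (j j' : ℕ), (K.Ξ ι').knot j' < (K.Ξ ι').knot (j' + 1) →
    (K.Ξ ι).knot (j + 1) - (K.Ξ ι).knot j ≤ θ * ((K.Ξ ι').knot (j' + 1) - (K.Ξ ι').knot j')

end Patch

/-! ### Normal derivatives -/

/-- `n` is the outer unit normal to `Ω` at the boundary point `x`: near `x`, the set `Ω` is, up to
first order, the half space `{y | ⟪y - x, n⟫ < 0}`. -/
def IsOuterNormal {d : ℕ} (Ω : Set (E d)) (x n : E d) : Prop :=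
  ‖n‖ = 1 ∧ ∀ ε : ℝ, 0 < ε → ∀ᶠ y in 𝓝 x,
    (y ∈ Ω → ⟪y - x, n⟫_ℝ ≤ ε * ‖y - x‖) ∧ (y ∉ Ω → -(ε * ‖y - x‖) ≤ ⟪y - x, n⟫_ℝ)

open Classical in
/-- The outer unit normal (`0` where there is none). -/
noncomputable def outerNormal {d : ℕ} (Ω : Set (E d)) (x : E d) : E d :=
  if h : ∃ n, IsOuterNormal Ω x n then h.choose else 0

/-- The derivative of `u` on the boundary of the patch in the direction of the outer normal, `u`
being differentiated from within the closed patch. -/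
noncomputable def Patch.normalDeriv {d : ℕ} (K : Patch d) (u : E d → ℝ) (x : E d) : ℝ :=
  ⟪gradientWithin u K.closedDom x, outerNormal K.dom x⟫_ℝ

/-! ### Multipatch domains -/

/-- A multipatch domain consisting of `N` non-overlapping patches, with a Dirichlet boundary which
is a union of complete patch sides on the boundary of the domain
`interior (⋃ k, closure (patch k))`. -/
structure Multipatch (d N : ℕ) where
  patch : Fin N → Patch d
  disjoint : ∀ k l, k ≠ l → Disjoint (patch k).dom (patch l).dom
  dirichlet : Set (Fin N × Fin d × Bool)
  dirichlet_subset : ∀ s ∈ dirichlet,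
    (patch s.1).side s.2.1 s.2.2 ⊆ frontier (interior (⋃ k, (patch k).closedDom))

namespace Multipatch

variable {d N : ℕ} (M : Multipatch d N)

/-- The dG space `V_{D,h}`: families of patchwise B-spline functions (with independent values on
the two sides of an interface) that vanish on the Dirichlet boundary. -/
noncomputable def space : Submodule ℝ (Fin N → E d → ℝ) where
  carrier := {u | (∀ k, u k ∈ (M.patch k).space) ∧
    ∀ s ∈ M.dirichlet, ∀ x ∈ (M.patch s.1).side s.2.1 s.2.2, u s.1 x = 0}
  add_mem' := by
    rintro u v ⟨hu, hu'⟩ ⟨hv, hv'⟩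
    refine ⟨fun k => Submodule.add_mem _ (hu k) (hv k), fun s hs x hx => ?_⟩
    simp [hu' s hs x hx, hv' s hs x hx]
  zero_mem' := ⟨fun k => Submodule.zero_mem _, fun s hs x hx => rfl⟩
  smul_mem' := by
    rintro c u ⟨hu, hu'⟩
    refine ⟨fun k => Submodule.smul_mem _ c (hu k), fun s hs x hx => ?_⟩
    simp [hu' s hs x hx]

/-- The interface `F^{(kl)}` of two patches. -/
def interface (k l : Fin N) : Set (E d) := (M.patch k).closedDom ∩ (M.patch l).closedDom

open Classical in
/-- The patches `l ≠ k` whose interface with patch `k` is `(d-1)`-dimensional (an edge for `d = 2`,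
a face for `d = 3`), that is, has positive surface measure. -/
noncomputable def neighbours (k : Fin N) : Finset (Fin N) :=
  Finset.univ.filter fun l => l ≠ k ∧ 0 < μHE[d - 1] (M.interface k l)

/-- The harmonic average of the mesh sizes of two patches. -/
noncomputable def hAvg (k l : Fin N) : ℝ :=
  2 * (M.patch k).meshSize * (M.patch l).meshSize / ((M.patch k).meshSize + (M.patch l).meshSize)

variable (α : Fin N → ℝ) (δ : ℝ)

/-- `a^{(k)}(u,v)`. -/
noncomputable def aForm (k : Fin N) (u v : Fin N → E d → ℝ) : ℝ :=
  ∫ x in (M.patch k).dom, α k * ⟪∇ (u k) x, ∇ (v k) x⟫_ℝ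

/-- `s^{(k)}(u,v)`. -/
noncomputable def sForm (k : Fin N) (u v : Fin N → E d → ℝ) : ℝ :=
  ∑ l ∈ M.neighbours k, ∫ x in M.interface k l,
    α k / 2 * ((M.patch k).normalDeriv (u k) x * (v l x - v k x)
      + (M.patch k).normalDeriv (v k) x * (u l x - u k x)) ∂μHE[d - 1]

/-- `p^{(k)}(u,v)`. -/
noncomputable def pForm (k : Fin N) (u v : Fin N → E d → ℝ) : ℝ :=
  ∑ l ∈ M.neighbours k, ∫ x in M.interface k l,
    δ * α k / (2 * M.hAvg k l) * ((u l x - u k x) * (v l x - v k x)) ∂μHE[d - 1]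

/-- `a_e^{(k)}(u,v) = a^{(k)}(u,v) + s^{(k)}(u,v) + p^{(k)}(u,v)`. -/
noncomputable def aeForm (k : Fin N) (u v : Fin N → E d → ℝ) : ℝ :=
  M.aForm α k u v + M.sForm α k u v + M.pForm α δ k u v

/-- `a_h(u,v)`, the SIP dG bilinear form. -/
noncomputable def ahForm (u v : Fin N → E d → ℝ) : ℝ := ∑ k, M.aeForm α δ k u v

/-- `d^{(k)}(u,v) = a^{(k)}(u,v) + p^{(k)}(u,v)`. -/
noncomputable def dForm (k : Fin N) (u v : Fin N → E d → ℝ) : ℝ :=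
  M.aForm α k u v + M.pForm α δ k u v

/-- The square of the dG norm. -/
noncomputable def dgNormSq (u : Fin N → E d → ℝ) : ℝ :=
  ∑ k, (α k * (∫ x in (M.patch k).dom, ‖∇ (u k) x‖ ^ 2)
    + ∑ l ∈ M.neighbours k,
        δ * α k / M.hAvg k l * ∫ x in M.interface k l, (u k x - u l x) ^ 2 ∂μHE[d - 1])

end Multipatch

end IgA

/-! Since `aeForm` is `dForm` plus `sForm`, everything follows from |s(u,u)| ≤ d(u,u)/2 on each
patch (`exists_abs_sForm_le`). Young's inequality splits s into squares of normal derivatives on the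
interfaces and squares of jumps. The jumps are absorbed by the penalty once δ is large; the normal
derivatives are absorbed by the energy through the discrete trace inequality h ∫_∂Ω |∇u|² ≤ C ∫_Ω
|∇u|² (`Patch.exists_trace_bound`).

The trace inequality is proved cell by cell. On a mesh cell u ∘ G is a polynomial of coordinate
degree at most p, and so are its partial derivatives. Their point values are bounded by their mean
squares over the cell, with a constant depending on d and p only
(`exists_sq_le_integral_closedBox`): norms on a finite-dimensional space are equivalent, and affine
scaling carries the estimate from the unit cube to any box. The bi-Lipschitz bounds on G transfer
gradients, volumes and surface measures between a cell and its image
(`prod_mul_norm_gradientWithin_sq_le`); no Jacobian formula is needed, and the powers of H cancel.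
Quasi-uniformity bounds the ratio of surface to volume of a cell by a multiple of 1/h. Points on
interior knot planes are discarded, being null for the surface measure.

A patch may have many neighbours, so the interface integrals are summed by bounded overlap: a point
lies in at most m(d,κ) closed patches, because these occupy disjoint sets of comparable volume near
it (`card_closedDom_le`). -/

namespace IgA

/-! ### Boxes in Euclidean space -/

/-- The open box with lower corner `a` and upper corner `b`. -/
def box {d : ℕ} (a b : Fin d → ℝ) : Set (E d) := {ξ | ∀ ι, ξ ι ∈ Ioo (a ι) (b ι)}

/-- The closed box with lower corner `a` and upper corner `b`. -/
def closedBox {d : ℕ} (a b : Fin d → ℝ) : Set (E d) := {ξ | ∀ ι, ξ ι ∈ Icc (a ι) (b ι)}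

lemma box_eq_preimage {d : ℕ} (a b : Fin d → ℝ) :
    box a b = EuclideanSpace.equiv (Fin d) ℝ ⁻¹' (univ.pi fun ι => Ioo (a ι) (b ι)) := by
  ext ξ; simp [box]

lemma closedBox_eq_preimage {d : ℕ} (a b : Fin d → ℝ) :
    closedBox a b = EuclideanSpace.equiv (Fin d) ℝ ⁻¹' (univ.pi fun ι => Icc (a ι) (b ι)) := by
  ext ξ; simp [closedBox, Pi.le_def, forall_and]

lemma isOpen_box {d : ℕ} (a b : Fin d → ℝ) : IsOpen (box a b) := by
  rw [box_eq_preimage]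
  exact (isOpen_set_pi finite_univ fun _ _ => isOpen_Ioo).preimage
    (EuclideanSpace.equiv (Fin d) ℝ).continuous

lemma isCompact_closedBox {d : ℕ} (a b : Fin d → ℝ) : IsCompact (closedBox a b) := by
  rw [closedBox_eq_preimage]
  exact (EuclideanSpace.equiv (Fin d) ℝ).toHomeomorph.isCompact_preimage.2
    (isCompact_univ_pi fun _ => isCompact_Icc)

lemma box_subset_closedBox {d : ℕ} (a b : Fin d → ℝ) : box a b ⊆ closedBox a b :=
  fun _ h ι => Ioo_subset_Icc_self (h ι)

lemma closure_box {d : ℕ} {a b : Fin d → ℝ} (h : ∀ ι, a ι < b ι) :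
    closure (box a b) = closedBox a b := by
  rw [box_eq_preimage, closedBox_eq_preimage]
  have := (EuclideanSpace.equiv (Fin d) ℝ).toHomeomorph.preimage_closure
    (univ.pi fun ι => Ioo (a ι) (b ι))
  refine this.symm.trans ?_
  rw [closure_pi_set]
  simp [closure_Ioo (h _).ne]

lemma volume_preimage_euclidean {d : ℕ} (s : Set (Fin d → ℝ)) (hs : MeasurableSet s) :
    volume (EuclideanSpace.equiv (Fin d) ℝ ⁻¹' s) = volume s :=
  (EuclideanSpace.volume_preserving_symm_measurableEquiv_toLp (Fin d)).measure_preimage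
    hs.nullMeasurableSet

lemma volume_box {d : ℕ} (a b : Fin d → ℝ) :
    volume (box a b) = ∏ ι, ENNReal.ofReal (b ι - a ι) := by
  rw [box_eq_preimage, volume_preimage_euclidean _ (.univ_pi fun _ => measurableSet_Ioo),
    Real.volume_pi_Ioo]

lemma volume_closedBox {d : ℕ} (a b : Fin d → ℝ) :
    volume (closedBox a b) = ∏ ι, ENNReal.ofReal (b ι - a ι) := by
  rw [closedBox_eq_preimage, volume_preimage_euclidean _ (.univ_pi fun _ => measurableSet_Icc),
    volume_pi, Measure.pi_pi]
  simp

lemma volume_coord_eq {d : ℕ} (ι : Fin d) (t : ℝ) : volume {ξ : E d | ξ ι = t} = 0 := by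
  have : {ξ : E d | ξ ι = t} = EuclideanSpace.equiv (Fin d) ℝ ⁻¹' {x | x ι = t} := by
    ext; simp
  rw [this, volume_preimage_euclidean _ (measurableSet_eq_fun (measurable_pi_apply ι)
    measurable_const)]
  exact Measure.pi_hyperplane (α := fun _ => ℝ) (fun _ => volume) ι t

lemma isOpen_openCube (d : ℕ) : IsOpen (openCube d) := isOpen_box _ _

lemma isCompact_cube (d : ℕ) : IsCompact (cube d) := isCompact_closedBox _ _

lemma openCube_subset_cube (d : ℕ) : openCube d ⊆ cube d := box_subset_closedBox _ _

lemma closure_openCube (d : ℕ) : closure (openCube d) = cube d := closure_box fun _ => by simp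

lemma nonempty_openCube (d : ℕ) : (openCube d).Nonempty :=
  ⟨WithLp.toLp 2 fun _ => 1 / 2, fun ι => by norm_num⟩

lemma convex_cube (d : ℕ) : Convex ℝ (cube d) := by
  intro x hx y hy s t hs ht hst ι
  exact (convex_Icc (0 : ℝ) 1) (hx ι) (hy ι) hs ht hst

lemma uniqueDiffWithinAt_cube {d : ℕ} {ξ : E d} (h : ξ ∈ cube d) :
    UniqueDiffWithinAt ℝ (cube d) ξ :=
  uniqueDiffWithinAt_convex (convex_cube d)
    ((nonempty_openCube d).mono (interior_maximal (openCube_subset_cube d) (isOpen_openCube d)))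
    (subset_closure h)

/-- The boundary of the parameter domain. -/
def cubeBoundary (d : ℕ) : Set (E d) := ⋃ (ι : Fin d) (b : Bool), cubeSide d ι b

lemma cube_diff_openCube_subset (d : ℕ) : cube d \ openCube d ⊆ cubeBoundary d := by
  rintro ξ ⟨h, h'⟩
  simp only [openCube, mem_ofPred_eq, not_forall] at h'
  obtain ⟨ι, hι⟩ := h'
  simp only [cubeBoundary, mem_iUnion]
  by_cases h0 : ξ ι = 0
  · exact ⟨ι, false, h, by simpa using h0⟩
  · refine ⟨ι, true, h, ?_⟩
    by_contra h1
    exact hι ⟨lt_of_le_of_ne (h ι).1 (Ne.symm h0), lt_of_le_of_ne (h ι).2 (by simpa using h1)⟩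

lemma cubeSide_subset_cube (d : ℕ) (ι : Fin d) (b : Bool) : cubeSide d ι b ⊆ cube d :=
  fun _ h => h.1

lemma cubeBoundary_subset_cube (d : ℕ) : cubeBoundary d ⊆ cube d :=
  iUnion₂_subset fun ι b => cubeSide_subset_cube d ι b

lemma isCompact_cubeSide (d : ℕ) (ι : Fin d) (b : Bool) : IsCompact (cubeSide d ι b) :=
  (isCompact_cube d).inter_right
    (isClosed_eq (EuclideanSpace.proj (𝕜 := ℝ) ι).continuous continuous_const)

lemma isCompact_cubeBoundary (d : ℕ) : IsCompact (cubeBoundary d) :=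
  isCompact_iUnion fun ι => isCompact_iUnion fun b => isCompact_cubeSide d ι b

/-! ### Euclidean Hausdorff measure -/

/-- This replaces the change of variables formula, for volumes (where `μHE[d]` is Lebesgue measure
on `E d`) as well as for surface measures. -/
lemma euclideanHausdorffMeasure_image_le {X Y : Type*} [EMetricSpace X] [MeasurableSpace X]
    [BorelSpace X] [EMetricSpace Y] [MeasurableSpace Y] [BorelSpace Y] {K : NNReal} {f : X → Y}
    {s : Set X} (h : LipschitzOnWith K f s) (n : ℕ) :
    μHE[n] (f '' s) ≤ (K : ENNReal) ^ n * μHE[n] s := by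
  simp only [Measure.euclideanHausdorffMeasure_def, Measure.smul_apply, ENNReal.smul_def,
    smul_eq_mul]
  rw [mul_left_comm]
  gcongr
  simpa using h.hausdorffMeasure_image_le (d := n) (by positivity)

/-- Inserting a constant coordinate. -/
def insertCoord {n : ℕ} (ι : Fin (n + 1)) (t : ℝ) (y : E n) : E (n + 1) :=
  WithLp.toLp 2 (ι.insertNth t (fun j => y j))

lemma isometry_insertCoord {n : ℕ} (ι : Fin (n + 1)) (t : ℝ) : Isometry (insertCoord ι t) := by
  refine Isometry.of_dist_eq fun x y => ?_
  rw [EuclideanSpace.dist_eq, EuclideanSpace.dist_eq, Fin.sum_univ_succAbove _ ι]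
  simp [insertCoord]

lemma mem_range_insertCoord {n : ℕ} {ι : Fin (n + 1)} {t : ℝ} {ξ : E (n + 1)} (h : ξ ι = t) :
    ξ ∈ range (insertCoord ι t) := by
  refine ⟨WithLp.toLp 2 fun j => ξ (ι.succAbove j), ?_⟩
  ext i
  refine Fin.succAboveCases ι ?_ (fun j => ?_) i <;> simp [insertCoord, h]

lemma euclideanHausdorffMeasure_face {n : ℕ} (ι : Fin (n + 1)) (t : ℝ) (a b : Fin (n + 1) → ℝ) :
    μHE[n] {ξ ∈ closedBox a b | ξ ι = t} ≤
      ∏ j : Fin n, ENNReal.ofReal (b (ι.succAbove j) - a (ι.succAbove j)) := by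
  have : {ξ ∈ closedBox a b | ξ ι = t} ⊆
      insertCoord ι t '' closedBox (fun j => a (ι.succAbove j)) (fun j => b (ι.succAbove j)) := by
    rintro ξ ⟨h, h'⟩
    obtain ⟨y, rfl⟩ := mem_range_insertCoord h'
    refine ⟨y, fun j => ?_, rfl⟩
    simpa [insertCoord] using h (ι.succAbove j)
  refine (measure_mono this).trans ?_
  rw [(isometry_insertCoord ι t).euclideanHausdorffMeasure_image,
    EuclideanSpace.euclideanHausdorffMeasure_eq_volume, volume_closedBox]

lemma euclideanHausdorffMeasure_face_slice {n : ℕ} {ι ι' : Fin (n + 1)} (h : ι' ≠ ι) (t t' : ℝ) :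
    μHE[n] {ξ : E (n + 1) | ξ ι = t ∧ ξ ι' = t'} = 0 := by
  obtain ⟨j, rfl⟩ := Fin.exists_succAbove_eq h
  have : {ξ : E (n + 1) | ξ ι = t ∧ ξ (ι.succAbove j) = t'} ⊆
      insertCoord ι t '' {y | y j = t'} := by
    rintro ξ ⟨h, h'⟩
    obtain ⟨y, rfl⟩ := mem_range_insertCoord h
    exact ⟨y, by simpa [insertCoord] using h', rfl⟩
  refine measure_mono_null this ?_
  rw [(isometry_insertCoord ι t).euclideanHausdorffMeasure_image,
    EuclideanSpace.euclideanHausdorffMeasure_eq_volume, volume_coord_eq]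

/-! ### Polynomials of bounded coordinate degree -/

/-- Tensor product monomials. -/
def tensorMonomial {d p : ℕ} (m : Fin d → Fin (p + 1)) (x : E d) : ℝ := ∏ ι, x ι ^ (m ι : ℕ)

/-- The polynomial functions of degree at most `p` in each coordinate. -/
def tensorPoly (d p : ℕ) : Submodule ℝ (E d → ℝ) :=
  Submodule.span ℝ (range (tensorMonomial (d := d) (p := p)))

lemma prod_eval_mem_tensorPoly {d p : ℕ} {P : Fin d → Polynomial ℝ}
    (hP : ∀ ι, (P ι).natDegree ≤ p) : (fun x : E d => ∏ ι, (P ι).eval (x ι)) ∈ tensorPoly d p := by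
  have : (fun x : E d => ∏ ι, (P ι).eval (x ι)) =
      ∑ m : Fin d → Fin (p + 1), (∏ ι, (P ι).coeff (m ι)) • tensorMonomial m := by
    funext x
    simp only [Finset.sum_apply, Pi.smul_apply, smul_eq_mul, tensorMonomial,
      ← Finset.prod_mul_distrib]
    have h : ∀ ι, (P ι).eval (x ι) = ∑ k : Fin (p + 1), (P ι).coeff k * x ι ^ (k : ℕ) := by
      intro ι
      rw [Polynomial.eval_eq_sum_range' (Nat.lt_succ_of_le (hP ι)), Finset.sum_range]
    simp_rw [h]
    rw [Finset.prod_univ_sum]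
    simp
  rw [this]
  exact Submodule.sum_mem _ fun m _ => Submodule.smul_mem _ _ (Submodule.subset_span ⟨m, rfl⟩)

/-- The affine map taking the unit cube to the box with corners `a` and `b`. -/
def boxMap {d : ℕ} (a b : Fin d → ℝ) (y : E d) : E d :=
  WithLp.toLp 2 fun ι => a ι + (b ι - a ι) * y ι

/-- Invariance under coordinatewise affine maps is what makes the constant of the inverse estimate
the same for all boxes, however small or elongated. -/
lemma comp_boxMap_mem_tensorPoly {d p : ℕ} (a b : Fin d → ℝ) {f : E d → ℝ}
    (hf : f ∈ tensorPoly d p) : (f ∘ boxMap a b) ∈ tensorPoly d p := by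
  induction hf using Submodule.span_induction with
  | mem f hf =>
    obtain ⟨m, rfl⟩ := hf
    have := prod_eval_mem_tensorPoly (d := d) (p := p)
      (P := fun ι => (Polynomial.C (b ι - a ι) * Polynomial.X + Polynomial.C (a ι)) ^ (m ι : ℕ))
      (fun ι => (Polynomial.natDegree_pow_le).trans (by
        have : (Polynomial.C (b ι - a ι) * Polynomial.X + Polynomial.C (a ι)).natDegree ≤ 1 :=
          Polynomial.natDegree_linear_le
        have := (m ι).is_lt
        nlinarith))
    convert this using 2 with x
    simp [tensorMonomial, boxMap, add_comm]
  | zero => exact Submodule.zero_mem _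
  | add f g _ _ hf hg => exact Submodule.add_mem _ hf hg
  | smul c f _ hf => exact Submodule.smul_mem _ c hf

lemma contDiff_of_mem_tensorPoly {d p : ℕ} {f : E d → ℝ} (hf : f ∈ tensorPoly d p) :
    ContDiff ℝ 1 f := by
  induction hf using Submodule.span_induction with
  | mem f hf =>
    obtain ⟨m, rfl⟩ := hf
    unfold tensorMonomial
    fun_prop
  | zero => exact contDiff_const
  | add f g _ _ hf hg => exact hf.add hg
  | smul c f _ hf => exact hf.const_smul c

lemma fderiv_apply_mem_tensorPoly {d p : ℕ} {f : E d → ℝ} (hf : f ∈ tensorPoly d p) (i : Fin d) :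
    (fun x => fderiv ℝ f x (EuclideanSpace.single i 1)) ∈ tensorPoly d p := by
  induction hf using Submodule.span_induction with
  | mem f hf =>
    obtain ⟨m, rfl⟩ := hf
    have := prod_eval_mem_tensorPoly (d := d) (p := p)
      -- The partial derivative of a product of one-variable factors differentiates the `i`-th
      -- factor alone.
      (P := Function.update (fun ι => Polynomial.X ^ (m ι : ℕ)) i
        (Polynomial.derivative (Polynomial.X ^ (m i : ℕ))))
      (fun ι => by
        rcases eq_or_ne ι i with rfl | h
        · rw [Function.update_self]
          refine (Polynomial.natDegree_derivative_le _).trans ?_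
          have := (m ι).is_lt
          rw [Polynomial.natDegree_X_pow]; omega
        · rw [Function.update_of_ne h, Polynomial.natDegree_X_pow]
          exact Nat.lt_succ_iff.1 (m ι).is_lt)
    convert this using 2 with x
    have h1 : ∀ ι, HasFDerivAt (fun x : E d => x ι ^ (m ι : ℕ))
        (((m ι : ℕ) * x ι ^ ((m ι : ℕ) - 1)) • (EuclideanSpace.proj ι : E d →L[ℝ] ℝ)) x := fun ι =>
      (hasDerivAt_pow (m ι : ℕ) (x ι)).comp_hasFDerivAt x
        (EuclideanSpace.proj ι : E d →L[ℝ] ℝ).hasFDerivAt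
    have h2 := HasFDerivAt.finsetProd (u := Finset.univ) (x := x) fun ι _ => h1 ι
    have h3 : fderiv ℝ (tensorMonomial m) x = _ := h2.fderiv
    rw [h3, ← Finset.mul_prod_erase Finset.univ _ (Finset.mem_univ i)]
    simp only [sum_apply, smul_apply, smul_eq_mul]
    rw [Finset.sum_eq_single i (by intro b _ hb; simp [hb]) (by simp)]
    simp only [Function.update_self]
    rw [mul_comm]
    congr 1
    · simp [Polynomial.derivative_X_pow]
    · refine Finset.prod_congr rfl fun ι hι => ?_
      rw [Function.update_of_ne (Finset.ne_of_mem_erase hι)]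
      simp
  | zero => simp; exact Submodule.zero_mem _
  | add f g hf' hg' hf hg =>
    convert Submodule.add_mem _ hf hg using 2 with x
    rw [fderiv_add ((contDiff_of_mem_tensorPoly hf').differentiable one_ne_zero x)
      ((contDiff_of_mem_tensorPoly hg').differentiable one_ne_zero x)]
    simp
  | smul c f hf' hf =>
    convert Submodule.smul_mem _ c hf using 2 with x
    rw [fderiv_const_smul ((contDiff_of_mem_tensorPoly hf').differentiable one_ne_zero x)]
    simp

/-! ### Inverse estimate: point values of polynomials against their mean squares -/

instance (d p : ℕ) : FiniteDimensional ℝ (tensorPoly d p) :=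
  FiniteDimensional.span_of_finite ℝ (finite_range _)

instance (d : ℕ) : CompactSpace (cube d) := isCompact_iff_compactSpace.1 (isCompact_cube d)

/-- Restriction of polynomials to the unit cube. -/
noncomputable def restrictCube (d p : ℕ) : tensorPoly d p →ₗ[ℝ] C(cube d, ℝ) where
  toFun f := ⟨fun y => f.1 y,
    (contDiff_of_mem_tensorPoly f.2).continuous.comp continuous_subtype_val⟩
  map_add' _ _ := rfl
  map_smul' _ _ := rfl

/-- The closed cube is the closure of the open one, so each nonempty relatively open subset meets
the interior. Hence continuous functions on the cube that agree almost everywhere are equal. -/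
lemma isOpenPosMeasure_cube (d : ℕ) :
    (Measure.comap ((↑) : cube d → E d) volume).IsOpenPosMeasure := by
  refine ⟨fun U hU hne => ?_⟩
  obtain ⟨O, hO, rfl⟩ := isOpen_induced_iff.1 hU
  rw [comap_subtype_coe_apply (isCompact_cube d).measurableSet, Subtype.image_preimage_coe]
  obtain ⟨⟨x, hx⟩, hxO⟩ := hne
  rw [← closure_openCube] at hx
  obtain ⟨y, hy⟩ := mem_closure_iff.1 hx O hO hxO
  have h := (hO.inter (isOpen_openCube d)).measure_pos volume ⟨y, hy⟩
  refine (h.trans_le (measure_mono ?_)).ne'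
  rintro z ⟨h1, h2⟩
  exact ⟨openCube_subset_cube d h2, h1⟩

/-- The embedding of a finite-dimensional space of continuous functions into L² is injective, hence
bounded below: the sup norm is dominated by the L² norm. -/
lemma exists_sq_le_integral_cube (d p : ℕ) : ∃ C : ℝ, 0 < C ∧ ∀ f ∈ tensorPoly d p, ∀ x ∈ cube d,
    f x ^ 2 ≤ C * ∫ y in cube d, f y ^ 2 := by
  set μ : Measure (cube d) := Measure.comap ((↑) : cube d → E d) volume with hμ
  have : IsFiniteMeasure μ := by
    refine ⟨?_⟩
    rw [hμ, comap_subtype_coe_apply (isCompact_cube d).measurableSet, image_univ,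
      Subtype.range_coe]
    exact (isCompact_cube d).measure_lt_top
  have := isOpenPosMeasure_cube d
  rw [← hμ] at this
  -- Working with the restrictions themselves avoids showing that a polynomial is determined by its
  -- values on the cube.
  let V := LinearMap.range (restrictCube d p)
  let T : V →L[ℝ] Lp ℝ 2 μ := (ContinuousMap.toLp 2 μ ℝ).comp V.subtypeL
  have hT : T.ker = ⊥ := by
    rw [LinearMap.ker_eq_bot]
    exact (ContinuousMap.toLp_injective μ).comp Subtype.val_injective
  obtain ⟨K, hK, hTK⟩ := LinearMap.exists_antilipschitzWith (𝕜 := ℝ) (E := V) (F := Lp ℝ 2 μ)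
    T.toLinearMap hT
  refine ⟨(K : ℝ) ^ 2, by positivity, fun f hf x hx => ?_⟩
  let F : C(cube d, ℝ) := restrictCube d p ⟨f, hf⟩
  let v : V := ⟨F, ⟨_, rfl⟩⟩
  have h1 : |f x| ≤ ‖F‖ := F.norm_coe_le_norm ⟨x, hx⟩
  have h2 : ‖F‖ ≤ K * ‖T v‖ := by
    simpa using hTK.le_mul_dist v 0
  have h3 : ‖T v‖ ^ 2 = ∫ y in cube d, f y ^ 2 := by
    have := ContinuousMap.inner_toLp (𝕜 := ℝ) (μ := μ) F F
    rw [real_inner_self_eq_norm_sq] at this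
    refine this.trans ?_
    rw [← integral_subtype_comap (isCompact_cube d).measurableSet]
    refine integral_congr_ae (.of_forall fun y => ?_)
    simp [F, restrictCube, sq]
  rw [← h3, ← sq_abs, ← mul_pow]
  exact pow_le_pow_left₀ (abs_nonneg _) (h1.trans h2) 2

lemma smul_map_boxMap_volume {d : ℕ} {a b : Fin d → ℝ} (h : ∀ ι, a ι < b ι) :
    ENNReal.ofReal (∏ ι, (b ι - a ι)) • Measure.map (boxMap a b) volume = volume := by
  have hpos : 0 < ∏ ι, (b ι - a ι) := Finset.prod_pos fun ι _ => sub_pos.2 (h ι)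
  let e := (EuclideanSpace.equiv (Fin d) ℝ).toLinearEquiv
  let D : Matrix (Fin d) (Fin d) ℝ := Matrix.diagonal fun ι => b ι - a ι
  let f : E d →ₗ[ℝ] E d := e.symm.toLinearMap ∘ₗ Matrix.toLin' D ∘ₗ e.toLinearMap
  have hdet : LinearMap.det f = ∏ ι, (b ι - a ι) := by
    have : LinearMap.det f = LinearMap.det (Matrix.toLin' D) :=
      LinearMap.det_conj (Matrix.toLin' D) e.symm
    rw [this, LinearMap.det_toLin', Matrix.det_diagonal]
  have hf := Measure.map_linearMap_addHaar_eq_smul_addHaar volume (f := f)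
    (by rw [hdet]; exact hpos.ne')
  have hcomp : boxMap a b = (fun x => WithLp.toLp 2 a + x) ∘ f := by
    funext y
    ext ι
    simp [boxMap, f, e, D, Matrix.mulVec_diagonal]
  have hfm : Measurable f := f.continuous_of_finiteDimensional.measurable
  rw [hcomp, ← Measure.map_map (measurable_const_add _) hfm, hf, Measure.map_smul,
    (measurePreserving_add_left volume _).map_eq, smul_smul, hdet, ← ENNReal.ofReal_mul hpos.le,
    abs_of_pos (inv_pos.2 hpos), mul_inv_cancel₀ hpos.ne', ENNReal.ofReal_one, one_smul]

lemma integral_box_boxMap {d : ℕ} {a b : Fin d → ℝ} (h : ∀ ι, a ι < b ι) (f : E d → ℝ) :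
    ∫ x in closedBox a b, f x = (∏ ι, (b ι - a ι)) * ∫ y in cube d, f (boxMap a b y) := by
  have hpos : 0 < ∏ ι, (b ι - a ι) := Finset.prod_pos fun ι _ => sub_pos.2 (h ι)
  have hc : Continuous (boxMap a b) := by unfold boxMap; fun_prop
  have hinj : Function.Injective (boxMap a b) := by
    intro x y hxy
    ext ι
    have := congrArg (fun z : E d => z ι) hxy
    simpa [boxMap, (sub_pos.2 (h ι)).ne'] using this
  have hemb : MeasurableEmbedding (boxMap a b) := hc.measurableEmbedding hinj
  have hpre : boxMap a b ⁻¹' closedBox a b = cube d := by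
    ext y
    refine forall_congr' fun ι => ?_
    have := sub_pos.2 (h ι)
    simp only [boxMap, mem_Icc]
    constructor
    · rintro ⟨h1, h2⟩; constructor <;> nlinarith
    · rintro ⟨h1, h2⟩; constructor <;> nlinarith
  conv_lhs => rw [← smul_map_boxMap_volume h]
  rw [Measure.restrict_smul, integral_smul_measure, hemb.setIntegral_map, hpre,
    ENNReal.toReal_ofReal hpos.le, smul_eq_mul]

lemma exists_sq_le_integral_closedBox (d p : ℕ) : ∃ C : ℝ, 0 < C ∧ ∀ f ∈ tensorPoly d p,
    ∀ a b : Fin d → ℝ, (∀ ι, a ι < b ι) → ∀ x ∈ closedBox a b,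
    (∏ ι, (b ι - a ι)) * f x ^ 2 ≤ C * ∫ y in closedBox a b, f y ^ 2 := by
  obtain ⟨C, hC, H⟩ := exists_sq_le_integral_cube d p
  refine ⟨C, hC, fun f hf a b hab x hx => ?_⟩
  rw [integral_box_boxMap hab]
  have hpos : 0 < ∏ ι, (b ι - a ι) := Finset.prod_pos fun ι _ => sub_pos.2 (hab ι)
  let y : E d := WithLp.toLp 2 fun ι => (x ι - a ι) / (b ι - a ι)
  have hy : y ∈ cube d := fun ι => by
    have h1 := sub_pos.2 (hab ι)
    have h2 := hx ι
    simp only [y, mem_Icc]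
    exact ⟨div_nonneg (by linarith [h2.1]) h1.le, (div_le_one h1).2 (by linarith [h2.2])⟩
  have hyx : boxMap a b y = x := by
    ext ι
    have h1 := (sub_pos.2 (hab ι)).ne'
    simp only [boxMap, y]
    field_simp
    ring
  have := H _ (comp_boxMap_mem_tensorPoly a b hf) y hy
  simp only [Function.comp_apply, hyx] at this
  rw [mul_left_comm]
  exact mul_le_mul_of_nonneg_left this hpos.le

/-! ### B-splines on knot spans -/

namespace KnotVector

variable (Ξ : KnotVector)

lemma knot_nonneg (i : ℕ) : 0 ≤ Ξ.knot i := by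
  rw [← Ξ.knot_left 0 (Nat.zero_le _)]
  exact Ξ.mono (Nat.zero_le i)

lemma knot_le_one (i : ℕ) : Ξ.knot i ≤ 1 := by
  rw [← Ξ.knot_right (max i Ξ.num) (le_max_right _ _)]
  exact Ξ.mono (le_max_left _ _)

lemma lt_num {j : ℕ} (h : Ξ.knot j < Ξ.knot (j + 1)) : j < Ξ.num := by
  by_contra hj
  rw [Ξ.knot_right j (not_lt.1 hj), Ξ.knot_right (j + 1) (by omega)] at h
  exact lt_irrefl _ h

/-- The part of the `j`-th knot span that is open relative to `[0,1]`. -/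
def relSpan (j : ℕ) : Set ℝ :=
  -- The values -1 and 2 only serve to keep the end points 0 and 1 in the first and last nonempty
  -- spans.
  Icc 0 1 ∩ Ioo (if Ξ.knot j ≤ 0 then -1 else Ξ.knot j)
    (if 1 ≤ Ξ.knot (j + 1) then 2 else Ξ.knot (j + 1))

lemma relSpan_subset_Icc (j : ℕ) : Ξ.relSpan j ⊆ Icc (Ξ.knot j) (Ξ.knot (j + 1)) := by
  rintro x ⟨⟨h0, h1⟩, h2, h3⟩
  have := Ξ.knot_nonneg j
  have := Ξ.knot_le_one (j + 1)
  constructor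
  · split_ifs at h2 <;> linarith
  · split_ifs at h3 <;> linarith

lemma Ioo_subset_relSpan (j : ℕ) : Ioo (Ξ.knot j) (Ξ.knot (j + 1)) ⊆ Ξ.relSpan j := by
  rintro x ⟨h0, h1⟩
  have := Ξ.knot_nonneg j
  have := Ξ.knot_le_one (j + 1)
  refine ⟨⟨by linarith, by linarith⟩, ?_, ?_⟩
  · split_ifs <;> linarith
  · split_ifs <;> linarith

/-- The exceptional points are interior knots: the end points 0 and 1 always belong to a span. This
keeps the sides of the cube from being exceptional as a whole. -/
lemma mem_relSpan_or_knot {x : ℝ} (hx : x ∈ Icc (0 : ℝ) 1) :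
    (∃ j, Ξ.knot j < Ξ.knot (j + 1) ∧ x ∈ Ξ.relSpan j) ∨
      ∃ j, x = Ξ.knot j ∧ x ∈ Ioo (0 : ℝ) 1 := by
  classical
  have h0 := Ξ.knot_left 0 (Nat.zero_le _)
  have hn := Ξ.knot_right Ξ.num le_rfl
  rcases hx.2.lt_or_eq with h1 | rfl
  · have hex : ∃ i, x < Ξ.knot i := ⟨Ξ.num, by rwa [hn]⟩
    obtain ⟨j, hj⟩ : ∃ j, Nat.find hex = j + 1 := Nat.exists_eq_succ_of_ne_zero fun h => by
      have := Nat.find_spec hex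
      rw [h, h0] at this
      exact not_lt.2 hx.1 this
    have hlt : x < Ξ.knot (j + 1) := hj ▸ Nat.find_spec hex
    have hle : Ξ.knot j ≤ x := not_lt.1 (Nat.find_min hex (by omega : j < Nat.find hex))
    rcases hle.lt_or_eq with h | h
    · exact Or.inl ⟨j, hle.trans_lt hlt, Ξ.Ioo_subset_relSpan j ⟨h, hlt⟩⟩
    · rcases hx.1.lt_or_eq with h0 | rfl
      · exact Or.inr ⟨j, h.symm, h0, h1⟩
      · refine Or.inl ⟨j, h.trans_lt hlt, hx, ?_, ?_⟩
        · rw [if_pos h.le]; norm_num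
        · split_ifs <;> linarith
  · have hex : ∃ i, 1 ≤ Ξ.knot i := ⟨Ξ.num, hn.ge⟩
    obtain ⟨j, hj⟩ : ∃ j, Nat.find hex = j + 1 := Nat.exists_eq_succ_of_ne_zero fun h => by
      have := Nat.find_spec hex
      rw [h, h0] at this
      linarith
    have hge : 1 ≤ Ξ.knot (j + 1) := hj ▸ Nat.find_spec hex
    have hlt : Ξ.knot j < 1 := not_le.1 (Nat.find_min hex (by omega : j < Nat.find hex))
    refine Or.inl ⟨j, hlt.trans_le hge, hx, ?_, ?_⟩
    · split_ifs <;> linarith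
    · rw [if_pos hge]; norm_num

lemma exists_knot_lt : ∃ j, Ξ.knot j < Ξ.knot (j + 1) := by
  by_contra! h
  have h0 : ∀ j, Ξ.knot j = 0 := fun j => by
    induction j with
    | zero => exact Ξ.knot_left 0 (Nat.zero_le _)
    | succ j ih => exact le_antisymm (ih ▸ h j) (Ξ.knot_nonneg _)
  have := Ξ.knot_right Ξ.num le_rfl
  rw [h0] at this
  exact zero_ne_one this

/-- The Cox-de Boor recursion raises the degree by at most one per step. The identity has to hold up
to 0 and 1, since gradients are evaluated on the patch boundary. -/
lemma exists_polynomial {j : ℕ} (hj : Ξ.knot j < Ξ.knot (j + 1)) (p i : ℕ) :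
    ∃ P : Polynomial ℝ, P.natDegree ≤ p ∧ ∀ x ∈ Ξ.relSpan j, bspline Ξ.knot p i x = P.eval x := by
  induction p generalizing i with
  | zero =>
    refine ⟨Polynomial.C (if i = j then 1 else 0), (Polynomial.natDegree_C _).le, fun x hx => ?_⟩
    have hx' := Ξ.relSpan_subset_Icc j hx
    have hb1 := Ξ.knot_le_one
    -- The right end of a span lies in `relSpan` only if it is 1, which is the case treated by the
    -- second clause of the degree-zero B-spline.
    have hcase : x < Ξ.knot (j + 1) ∨ (Ξ.knot (j + 1) = 1 ∧ x = 1) := by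
      rcases hx'.2.lt_or_eq with h | h
      · exact Or.inl h
      · have h2 := hx.2.2
        split_ifs at h2 with h3
        · have := hb1 (j + 1)
          exact Or.inr ⟨le_antisymm this h3, h.trans (le_antisymm this h3)⟩
        · exact absurd h h2.ne
    rw [Polynomial.eval_C, bspline]
    congr 1
    rw [eq_iff_iff]
    constructor
    · intro h
      by_contra hij
      rcases lt_or_gt_of_ne hij with hij | hij
      · have := Ξ.mono (show i + 1 ≤ j from hij)
        rcases h with ⟨_, h⟩ | ⟨_, h, rfl⟩
        · linarith [hx'.1]
        · linarith [hb1 (j + 1)]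
      · have := Ξ.mono (show j + 1 ≤ i from hij)
        rcases h with ⟨h, h'⟩ | ⟨h, h', rfl⟩
        · rcases hcase with hc | ⟨hc, rfl⟩
          · linarith
          · linarith [hb1 (i + 1)]
        · linarith [hx'.2]
    · rintro rfl
      rcases hcase with hc | ⟨hc, rfl⟩
      · exact Or.inl ⟨hx'.1, hc⟩
      · exact Or.inr ⟨hj, hc, rfl⟩
  | succ p ih =>
    obtain ⟨P, hP, hP'⟩ := ih i
    obtain ⟨Q, hQ, hQ'⟩ := ih (i + 1)
    refine ⟨(Polynomial.C (Ξ.knot (i + p + 1) - Ξ.knot i)⁻¹ * (Polynomial.X - Polynomial.C (Ξ.knot i))) * P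
      + (Polynomial.C (Ξ.knot (i + p + 2) - Ξ.knot (i + 1))⁻¹ *
        (Polynomial.C (Ξ.knot (i + p + 2)) - Polynomial.X)) * Q, ?_, fun x hx => ?_⟩
    · refine Polynomial.natDegree_add_le_of_degree_le ?_ ?_
      · rw [add_comm p 1]
        refine Polynomial.natDegree_mul_le_of_le ?_ hP
        refine (Polynomial.natDegree_C_mul_le _ _).trans ?_
        exact (Polynomial.natDegree_X_sub_C _).le
      · rw [add_comm p 1]
        refine Polynomial.natDegree_mul_le_of_le ?_ hQ
        refine (Polynomial.natDegree_C_mul_le _ _).trans ?_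
        exact (Polynomial.natDegree_sub_le _ _).trans (by simp)
    · rw [bspline, hP' x hx, hQ' x hx]
      simp [div_eq_inv_mul]

lemma measurable_bspline (t : ℕ → ℝ) (p i : ℕ) : Measurable (bspline t p i) := by
  classical
  induction p generalizing i with
  | zero =>
    have : bspline t 0 i = fun x =>
        if (t i ≤ x ∧ x < t (i + 1)) ∨ (t i < t (i + 1) ∧ t (i + 1) = 1 ∧ x = 1) then 1 else 0 := by
      funext x; rw [bspline]
    rw [this]
    refine Measurable.ite ?_ measurable_const measurable_const
    have hA : MeasurableSet {x : ℝ | t i < t (i + 1) ∧ t (i + 1) = 1 ∧ x = 1} := by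
      by_cases h : t i < t (i + 1) ∧ t (i + 1) = 1
      · convert measurableSet_singleton (1 : ℝ) using 1
        ext x
        exact ⟨fun hx => hx.2.2, fun hx => ⟨h.1, h.2, hx⟩⟩
      · convert MeasurableSet.empty (α := ℝ) using 1
        ext x
        simp only [mem_empty_iff_false, iff_false]
        exact fun hx => h ⟨hx.1, hx.2.1⟩
    exact (measurableSet_Ico (a := t i) (b := t (i + 1))).union hA
  | succ p ih =>
    have : bspline t (p + 1) i = fun x => (x - t i) / (t (i + p + 1) - t i) * bspline t p i x
        + (t (i + p + 2) - x) / (t (i + p + 2) - t (i + 1)) * bspline t p (i + 1) x := by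
      funext x; rw [bspline]
    rw [this]
    exact (((measurable_id.sub_const _).div_const _).mul (ih i)).add
      (((measurable_id.const_sub _).div_const _).mul (ih (i + 1)))

lemma bspline_bounded (t : ℕ → ℝ) (p i : ℕ) :
    ∃ C, ∀ x ∈ Icc (0 : ℝ) 1, |bspline t p i x| ≤ C := by
  induction p generalizing i with
  | zero =>
    refine ⟨1, fun x _ => ?_⟩
    unfold bspline
    split_ifs <;> simp
  | succ p ih =>
    obtain ⟨C, hC⟩ := ih i
    obtain ⟨C', hC'⟩ := ih (i + 1)
    refine ⟨(1 + |t i|) / |t (i + p + 1) - t i| * C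
      + (|t (i + p + 2)| + 1) / |t (i + p + 2) - t (i + 1)| * C', fun x hx => ?_⟩
    have hx' : |x| ≤ 1 := abs_le.2 ⟨by linarith [hx.1], hx.2⟩
    rw [bspline]
    refine (abs_add_le _ _).trans ?_
    rw [abs_mul, abs_mul, abs_div, abs_div]
    gcongr
    · exact (abs_sub _ _).trans (by gcongr)
    · exact hC x hx
    · exact (abs_sub _ _).trans (by gcongr)
    · exact hC' x hx

end KnotVector

/-! ### Tensor product splines on mesh cells -/

section Cells

variable {d : ℕ} (Ξ : Fin d → KnotVector)

/-- The mesh cells with nonempty interior. -/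
def IsProperCell (j : Fin d → ℕ) : Prop := ∀ ι, (Ξ ι).knot (j ι) < (Ξ ι).knot (j ι + 1)

/-- The lower corner of a mesh cell. -/
def cellLower (j : Fin d → ℕ) (ι : Fin d) : ℝ := (Ξ ι).knot (j ι)

/-- The upper corner of a mesh cell. -/
def cellUpper (j : Fin d → ℕ) (ι : Fin d) : ℝ := (Ξ ι).knot (j ι + 1)

/-- The interior of a mesh cell relative to the closed parameter domain. -/
def relCell (j : Fin d → ℕ) : Set (E d) := {ξ | ∀ ι, ξ ι ∈ (Ξ ι).relSpan (j ι)}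

/-- The interior of a mesh cell. -/
def openCell (j : Fin d → ℕ) : Set (E d) := box (cellLower Ξ j) (cellUpper Ξ j)

/-- The closed mesh cell. -/
def closedCell (j : Fin d → ℕ) : Set (E d) := closedBox (cellLower Ξ j) (cellUpper Ξ j)

/-- Linear combinations of tensor product B-splines. -/
noncomputable def spline (c : (∀ ι, Fin (Ξ ι).num) → ℝ) (ξ : E d) : ℝ :=
  ∑ i, c i * tensorBSpline Ξ i ξ

variable {Ξ}

lemma relCell_eq (j : Fin d → ℕ) : relCell Ξ j = cube d ∩
    box (fun ι => if (Ξ ι).knot (j ι) ≤ 0 then -1 else (Ξ ι).knot (j ι))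
      (fun ι => if 1 ≤ (Ξ ι).knot (j ι + 1) then 2 else (Ξ ι).knot (j ι + 1)) := by
  ext ξ
  exact ⟨fun h => ⟨fun ι => (h ι).1, fun ι => (h ι).2⟩, fun h ι => ⟨h.1 ι, h.2 ι⟩⟩

lemma relCell_subset_cube (j : Fin d → ℕ) : relCell Ξ j ⊆ cube d := fun _ h ι => (h ι).1

lemma relCell_mem_nhdsWithin {j : Fin d → ℕ} {ξ : E d} (h : ξ ∈ relCell Ξ j) :
    relCell Ξ j ∈ 𝓝[cube d] ξ := by
  rw [relCell_eq] at h ⊢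
  exact inter_mem self_mem_nhdsWithin (mem_nhdsWithin_of_mem_nhds ((isOpen_box _ _).mem_nhds h.2))

lemma measurableSet_relCell (j : Fin d → ℕ) : MeasurableSet (relCell Ξ j) := by
  rw [relCell_eq]
  exact (isCompact_cube d).measurableSet.inter (isOpen_box _ _).measurableSet

lemma relCell_subset_closedCell (j : Fin d → ℕ) : relCell Ξ j ⊆ closedCell Ξ j :=
  fun _ h ι => (Ξ ι).relSpan_subset_Icc _ (h ι)

lemma openCell_subset_relCell (j : Fin d → ℕ) : openCell Ξ j ⊆ relCell Ξ j :=
  fun _ h ι => (Ξ ι).Ioo_subset_relSpan _ (h ι)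

lemma openCell_subset_openCube (j : Fin d → ℕ) : openCell Ξ j ⊆ openCube d :=
  fun _ h ι => ⟨((Ξ ι).knot_nonneg _).trans_lt (h ι).1, (h ι).2.trans_le ((Ξ ι).knot_le_one _)⟩

lemma isOpen_openCell (j : Fin d → ℕ) : IsOpen (openCell Ξ j) := isOpen_box _ _

lemma closure_openCell {j : Fin d → ℕ} (hj : IsProperCell Ξ j) :
    closure (openCell Ξ j) = closedCell Ξ j := closure_box hj

lemma disjoint_openCell {j j' : Fin d → ℕ} (h : j ≠ j') :
    Disjoint (openCell Ξ j) (openCell Ξ j') := by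
  rw [Set.disjoint_left]
  intro ξ hξ hξ'
  obtain ⟨ι, hι⟩ := Function.ne_iff.1 h
  rcases lt_or_gt_of_ne hι with hlt | hlt
  · have h1 := (Ξ ι).mono (show j ι + 1 ≤ j' ι from hlt)
    exact absurd ((hξ ι).2.trans_le h1) (not_lt.2 (hξ' ι).1.le)
  · have h1 := (Ξ ι).mono (show j' ι + 1 ≤ j ι from hlt)
    exact absurd ((hξ' ι).2.trans_le h1) (not_lt.2 (hξ ι).1.le)

lemma exists_mem_tensorPoly {p : ℕ} (hp : ∀ ι, (Ξ ι).deg ≤ p) {j : Fin d → ℕ}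
    (hj : IsProperCell Ξ j) (c : (∀ ι, Fin (Ξ ι).num) → ℝ) :
    ∃ f ∈ tensorPoly d p, ∀ ξ ∈ relCell Ξ j, spline Ξ c ξ = f ξ := by
  have h : ∀ (i : ∀ ι, Fin (Ξ ι).num), ∃ f ∈ tensorPoly d p, ∀ ξ ∈ relCell Ξ j,
      tensorBSpline Ξ i ξ = f ξ := by
    intro i
    choose P hP hP' using fun ι => (Ξ ι).exists_polynomial (hj ι) (Ξ ι).deg (i ι)
    refine ⟨_, prod_eval_mem_tensorPoly (fun ι => (hP ι).trans (hp ι)), fun ξ hξ => ?_⟩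
    exact Finset.prod_congr rfl fun ι _ => hP' ι _ (hξ ι)
  choose f hf hf' using h
  refine ⟨∑ i, c i • f i, Submodule.sum_mem _ fun i _ => Submodule.smul_mem _ _ (hf i),
    fun ξ hξ => ?_⟩
  simp [spline, Finset.sum_apply, hf' _ ξ hξ]

lemma measurable_tensorBSpline (i : ∀ ι, Fin (Ξ ι).num) : Measurable (tensorBSpline Ξ i) := by
  unfold tensorBSpline
  refine Finset.measurable_fun_prod _ fun ι _ => ?_
  exact (KnotVector.measurable_bspline _ _ _).comp
    (EuclideanSpace.proj (𝕜 := ℝ) ι).continuous.measurable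

lemma tensorBSpline_bounded (i : ∀ ι, Fin (Ξ ι).num) :
    ∃ C, ∀ ξ ∈ cube d, |tensorBSpline Ξ i ξ| ≤ C := by
  choose C hC using fun ι => KnotVector.bspline_bounded (Ξ ι).knot (Ξ ι).deg (i ι)
  refine ⟨∏ ι, C ι, fun ξ hξ => ?_⟩
  rw [tensorBSpline, Finset.abs_prod]
  exact Finset.prod_le_prod (fun _ _ => abs_nonneg _) fun ι _ => hC ι _ (hξ ι)

lemma exists_relCell_or_knot {ξ : E d} (hξ : ξ ∈ cube d) :
    (∃ j, IsProperCell Ξ j ∧ ξ ∈ relCell Ξ j) ∨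
      ∃ ι i, ξ ι = (Ξ ι).knot i ∧ ξ ι ∈ Ioo (0 : ℝ) 1 := by
  by_cases h : ∀ ι, ∃ j, (Ξ ι).knot j < (Ξ ι).knot (j + 1) ∧ ξ ι ∈ (Ξ ι).relSpan j
  · choose j hj hj' using h
    exact Or.inl ⟨j, hj, hj'⟩
  · push Not at h
    obtain ⟨ι, hι⟩ := h
    rcases (Ξ ι).mem_relSpan_or_knot (hξ ι) with ⟨j, h1, h2⟩ | ⟨i, hi⟩
    · exact absurd h2 (hι j h1)
    · exact Or.inr ⟨ι, i, hi⟩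

end Cells

/-! ### Bi-Lipschitz maps of the unit cube -/

/-- The lower bound is obtained along the ray `x + t • w`: divide by `t` and let `t` tend to 0 from
the right. -/
lemma bounds_of_hasFDerivAt {F F' : Type*} [NormedAddCommGroup F] [NormedSpace ℝ F]
    [NormedAddCommGroup F'] [NormedSpace ℝ F'] {g : F → F'} {T : F →L[ℝ] F'} {x : F} {a b : ℝ}
    (hb : 0 ≤ b) (hT : HasFDerivAt g T x)
    (h : ∀ᶠ y in 𝓝 x, a * ‖y - x‖ ≤ ‖g y - g x‖ ∧ ‖g y - g x‖ ≤ b * ‖y - x‖) (w : F) :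
    a * ‖w‖ ≤ ‖T w‖ ∧ ‖T w‖ ≤ b * ‖w‖ := by
  refine ⟨?_, (T.le_opNorm w).trans ?_⟩
  · refine le_of_forall_pos_le_add fun ε hε => ?_
    obtain ⟨η, hη, hηε⟩ : ∃ η > 0, η * ‖w‖ ≤ ε := by
      refine ⟨ε / (‖w‖ + 1), by positivity, ?_⟩
      rw [div_mul_eq_mul_div, div_le_iff₀ (by positivity)]
      nlinarith [norm_nonneg w]
    have h1 := (hT.isLittleO.def hη).and h
    have h2 : Tendsto (fun t : ℝ => x + t • w) (𝓝[>] 0) (𝓝 x) := by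
      have : Tendsto (fun t : ℝ => x + t • w) (𝓝 0) (𝓝 (x + (0 : ℝ) • w)) :=
        (Continuous.tendsto (by fun_prop) 0)
      rw [zero_smul, add_zero] at this
      exact this.mono_left nhdsWithin_le_nhds
    obtain ⟨t, ⟨h3, h4, -⟩, ht⟩ := ((h2.eventually h1).and self_mem_nhdsWithin).exists
    have ht : 0 < t := ht
    simp only [add_sub_cancel_left, map_smul, norm_smul, Real.norm_of_nonneg ht.le] at h3 h4
    have h5 := norm_sub_norm_le (g (x + t • w) - g x) (t • T w)
    rw [norm_smul, Real.norm_of_nonneg ht.le] at h5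
    have h6 : t * (a * ‖w‖) ≤ t * (‖T w‖ + η * ‖w‖) := by nlinarith
    have h7 := le_of_mul_le_mul_left h6 ht
    linarith
  · have := hT.le_of_lip' hb (h.mono fun _ hy => hy.2)
    gcongr

/-- `G` is bi-Lipschitz on the closed parameter domain. -/
def IsBiLipschitz {d : ℕ} (a b : ℝ) (G : E d → E d) : Prop :=
  ∀ ξ ∈ cube d, ∀ η ∈ cube d, a * ‖ξ - η‖ ≤ ‖G ξ - G η‖ ∧ ‖G ξ - G η‖ ≤ b * ‖ξ - η‖

namespace IsBiLipschitz

variable {d : ℕ} {a b : ℝ} {G : E d → E d}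

lemma lipschitzOnWith (h : IsBiLipschitz a b G) : LipschitzOnWith b.toNNReal G (cube d) := by
  refine LipschitzOnWith.of_dist_le_mul fun ξ hξ η hη => ?_
  rw [dist_eq_norm, dist_eq_norm]
  refine (h ξ hξ η hη).2.trans ?_
  gcongr
  exact Real.le_coe_toNNReal b

lemma injOn (ha : 0 < a) (h : IsBiLipschitz a b G) : InjOn G (cube d) := by
  intro ξ hξ η hη hG
  have := (h ξ hξ η hη).1
  rw [hG, sub_self, norm_zero] at this
  have h0 : ‖ξ - η‖ = 0 := le_antisymm (nonpos_of_mul_nonpos_right this ha) (norm_nonneg _)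
  exact sub_eq_zero.1 (norm_eq_zero.1 h0)

lemma continuousOn (h : IsBiLipschitz a b G) : ContinuousOn G (cube d) :=
  h.lipschitzOnWith.continuousOn

lemma invFunOn_apply (ha : 0 < a) (h : IsBiLipschitz a b G) {ξ : E d} (hξ : ξ ∈ cube d) :
    Function.invFunOn G (cube d) (G ξ) = ξ :=
  (h.injOn ha).leftInvOn_invFunOn hξ

lemma lipschitzOnWith_inv (ha : 0 < a) (h : IsBiLipschitz a b G) :
    LipschitzOnWith a⁻¹.toNNReal (Function.invFunOn G (cube d)) (G '' cube d) := by
  refine LipschitzOnWith.of_dist_le_mul ?_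
  rintro _ ⟨ξ, hξ, rfl⟩ _ ⟨η, hη, rfl⟩
  rw [dist_eq_norm, dist_eq_norm, h.invFunOn_apply ha hξ, h.invFunOn_apply ha hη,
    Real.coe_toNNReal _ (inv_pos.2 ha).le, ← div_eq_inv_mul, le_div_iff₀ ha, mul_comm]
  exact (h ξ hξ η hη).1

lemma measurableSet_image (ha : 0 < a) (h : IsBiLipschitz a b G) {A : Set (E d)}
    (hA : MeasurableSet A) (hAc : A ⊆ cube d) : MeasurableSet (G '' A) :=
  hA.image_of_continuousOn_injOn (h.continuousOn.mono hAc) ((h.injOn ha).mono hAc)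

lemma volume_le (ha : 0 < a) (h : IsBiLipschitz a b G) {A : Set (E d)} (hAc : A ⊆ cube d) :
    volume A ≤ ENNReal.ofReal a⁻¹ ^ d * volume (G '' A) := by
  have h1 : Function.invFunOn G (cube d) '' (G '' A) = A := by
    rw [image_image]
    refine (image_congr fun ξ hξ => ?_).trans (image_id A)
    exact h.invFunOn_apply ha (hAc hξ)
  have := euclideanHausdorffMeasure_image_le
    ((h.lipschitzOnWith_inv ha).mono (image_mono hAc)) d
  rwa [h1, EuclideanSpace.euclideanHausdorffMeasure_eq_volume] at this

lemma volume_image_le (h : IsBiLipschitz a b G) {A : Set (E d)} (hAc : A ⊆ cube d) :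
    volume (G '' A) ≤ ENNReal.ofReal b ^ d * volume A := by
  have := euclideanHausdorffMeasure_image_le (h.lipschitzOnWith.mono hAc) d
  rwa [EuclideanSpace.euclideanHausdorffMeasure_eq_volume] at this

/-- The inverse of `G` is Lipschitz with constant `a⁻¹`, so the push-forward of the volume on `A` is
at most `a⁻¹ ^ d` times the volume on the image. -/
lemma lintegral_comp_le (ha : 0 < a) (h : IsBiLipschitz a b G) {A : Set (E d)}
    (hA : MeasurableSet A) (hAc : A ⊆ cube d) {F : E d → ENNReal} (hF : Measurable F) :
    ∫⁻ ξ in A, F (G ξ) ≤ ENNReal.ofReal a⁻¹ ^ d * ∫⁻ x in G '' A, F x := by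
  have hG : AEMeasurable G (volume.restrict A) := (h.continuousOn.mono hAc).aemeasurable hA
  have hle : Measure.map G (volume.restrict A) ≤
      ENNReal.ofReal a⁻¹ ^ d • volume.restrict (G '' A) := by
    refine Measure.le_iff.2 fun S hS => ?_
    rw [Measure.map_apply_of_aemeasurable hG hS, Measure.restrict_apply' hA, Measure.smul_apply,
      Measure.restrict_apply hS, smul_eq_mul]
    refine (h.volume_le ha (inter_subset_right.trans hAc)).trans ?_
    gcongr
    rintro _ ⟨ξ, ⟨h1, h2⟩, rfl⟩
    exact ⟨h1, mem_image_of_mem G h2⟩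
  rw [← lintegral_map' hF.aemeasurable hG]
  refine (lintegral_mono' hle le_rfl).trans ?_
  rw [lintegral_smul_measure, smul_eq_mul]

end IsBiLipschitz

/-! ### Derivatives on a mesh cell and on its image -/

lemma norm_gradientWithin {d : ℕ} (u : E d → ℝ) (s : Set (E d)) (x : E d) :
    ‖gradientWithin u s x‖ = ‖fderivWithin ℝ u s x‖ := by
  simp [gradientWithin]

lemma norm_gradient {d : ℕ} (u : E d → ℝ) (x : E d) : ‖∇ u x‖ = ‖fderiv ℝ u x‖ := by
  simp [gradient]

lemma measurable_norm_gradient {d : ℕ} (u : E d → ℝ) : Measurable fun x => ‖∇ u x‖ := by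
  simp_rw [norm_gradient]
  exact (measurable_fderiv ℝ u).norm

lemma norm_sq_le_sum_sq {d : ℕ} (L : E d →L[ℝ] ℝ) :
    ‖L‖ ^ 2 ≤ ∑ i, L (EuclideanSpace.single i 1) ^ 2 := by
  have h0 : 0 ≤ ∑ i, L (EuclideanSpace.single i 1) ^ 2 := Finset.sum_nonneg fun _ _ => sq_nonneg _
  rw [← Real.sq_sqrt h0]
  refine pow_le_pow_left₀ (norm_nonneg _) (L.opNorm_le_bound (Real.sqrt_nonneg _) fun x => ?_) 2
  have hx : x = ∑ i, x i • EuclideanSpace.single i (1 : ℝ) := by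
    have := (EuclideanSpace.basisFun (Fin d) ℝ).sum_repr x
    simpa using this.symm
  conv_lhs => rw [hx]
  rw [map_sum, EuclideanSpace.norm_eq, ← Real.sqrt_mul h0]
  simp only [map_smul, smul_eq_mul]
  rw [Real.norm_eq_abs]
  refine Real.abs_le_sqrt ?_
  refine (Finset.sum_mul_sq_le_sq_mul_sq _ _ _).trans ?_
  simp [mul_comm]

section Cell

variable {d : ℕ} {Ξ : Fin d → KnotVector} {j : Fin d → ℕ} {a b : ℝ} {G g : E d → E d}
  {u f : E d → ℝ}

lemma nhds_relCell_of_mem_openCell {ξ : E d} (hξ : ξ ∈ openCell Ξ j) : relCell Ξ j ∈ 𝓝 ξ :=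
  mem_of_superset ((isOpen_openCell j).mem_nhds hξ) (openCell_subset_relCell j)

/-- In the open cell the derivative inherits the bi-Lipschitz bounds of `G`; by continuity of the
derivative of `g` they persist on the closed cell, where `G` need not coincide with `g` on a full
neighbourhood. -/
lemma fderiv_bounds (hb : 0 ≤ b) (hj : IsProperCell Ξ j) (hG : IsBiLipschitz a b G)
    (hg : ContDiff ℝ 1 g) (hGg : ∀ ξ ∈ relCell Ξ j, G ξ = g ξ) {ξ : E d}
    (hξ : ξ ∈ closedCell Ξ j) (w : E d) :
    a * ‖w‖ ≤ ‖fderiv ℝ g ξ w‖ ∧ ‖fderiv ℝ g ξ w‖ ≤ b * ‖w‖ := by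
  have hc : Continuous fun ξ => ‖fderiv ℝ g ξ w‖ :=
    ((hg.continuous_fderiv one_ne_zero).clm_apply continuous_const).norm
  have hcl : IsClosed {ξ | a * ‖w‖ ≤ ‖fderiv ℝ g ξ w‖ ∧ ‖fderiv ℝ g ξ w‖ ≤ b * ‖w‖} :=
    (isClosed_le continuous_const hc).inter (isClosed_le hc continuous_const)
  rw [← closure_openCell hj] at hξ
  refine closure_minimal (fun η hη => ?_) hcl hξ
  refine bounds_of_hasFDerivAt hb (hg.differentiable one_ne_zero η).hasFDerivAt ?_ w
  have hηr := openCell_subset_relCell j hη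
  filter_upwards [nhds_relCell_of_mem_openCell hη] with y hy
  rw [← hGg y hy, ← hGg η hηr]
  exact hG y (relCell_subset_cube j hy) η (relCell_subset_cube j hηr)

/-- Chain rule within the closed cube, where derivatives are unique, and invertibility of the
derivative of `g`. The bound reaches the patch boundary, where it is applied. -/
lemma norm_gradientWithin_le (ha : 0 < a) (hb : 0 ≤ b) (hj : IsProperCell Ξ j)
    (hG : IsBiLipschitz a b G) (hg : ContDiff ℝ 1 g) (hGg : ∀ ξ ∈ relCell Ξ j, G ξ = g ξ)
    (hf : ContDiff ℝ 1 f) (huf : ∀ ξ ∈ relCell Ξ j, u (G ξ) = f ξ) {ξ : E d}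
    (hξ : ξ ∈ relCell Ξ j) :
    ‖gradientWithin u (G '' cube d) (G ξ)‖ ≤ a⁻¹ * ‖fderiv ℝ f ξ‖ := by
  rw [norm_gradientWithin]
  by_cases hu : DifferentiableWithinAt ℝ u (G '' cube d) (G ξ)
  swap
  -- Where `u` is not differentiable its derivative is 0 by default and the bound is trivial, so
  -- differentiability at the boundary need not be proved.
  · rw [fderivWithin_zero_of_not_differentiableWithinAt hu, norm_zero]
    positivity
  set L := fderivWithin ℝ u (G '' cube d) (G ξ)
  have hξc := relCell_subset_cube j hξ
  have hnhds := relCell_mem_nhdsWithin hξ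
  have hGd : HasFDerivWithinAt G (fderiv ℝ g ξ) (cube d) ξ :=
    (hg.differentiable one_ne_zero ξ).hasFDerivAt.hasFDerivWithinAt.congr_of_eventuallyEq
      (by filter_upwards [hnhds] with y hy using hGg y hy) (hGg ξ hξ)
  have h1 : HasFDerivWithinAt (u ∘ G) (L.comp (fderiv ℝ g ξ)) (cube d) ξ :=
    hu.hasFDerivWithinAt.comp ξ hGd (mapsTo_image G _)
  have h2 : HasFDerivWithinAt (u ∘ G) (fderiv ℝ f ξ) (cube d) ξ :=
    (hf.differentiable one_ne_zero ξ).hasFDerivAt.hasFDerivWithinAt.congr_of_eventuallyEq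
      (by filter_upwards [hnhds] with y hy using huf y hy) (huf ξ hξ)
  have h3 := (uniqueDiffWithinAt_cube hξc).eq h1 h2
  have hT := fderiv_bounds hb hj hG hg hGg (relCell_subset_closedCell j hξ)
  have hinj : Function.Injective (fderiv ℝ g ξ).toLinearMap := by
    rw [← LinearMap.ker_eq_bot, LinearMap.ker_eq_bot']
    intro w hw
    have h4 := (hT w).1
    have hw : fderiv ℝ g ξ w = 0 := hw
    rw [hw, norm_zero] at h4
    exact norm_eq_zero.1 (le_antisymm (nonpos_of_mul_nonpos_right h4 ha) (norm_nonneg _))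
  refine L.opNorm_le_bound (by positivity) fun v => ?_
  obtain ⟨w, rfl⟩ := LinearMap.injective_iff_surjective.1 hinj v
  have h5 : L (fderiv ℝ g ξ w) = fderiv ℝ f ξ w := by rw [← h3]; rfl
  have h6 : ‖w‖ ≤ a⁻¹ * ‖fderiv ℝ g ξ w‖ := by
    rw [← div_eq_inv_mul, le_div_iff₀ ha, mul_comm]; exact (hT w).1
  calc ‖L (fderiv ℝ g ξ w)‖ = ‖fderiv ℝ f ξ w‖ := by rw [h5]
    _ ≤ ‖fderiv ℝ f ξ‖ * ‖w‖ := ContinuousLinearMap.le_opNorm _ _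
    _ ≤ ‖fderiv ℝ f ξ‖ * (a⁻¹ * ‖fderiv ℝ g ξ w‖) := by gcongr
    _ = _ := by rw [← mul_assoc, mul_comm ‖fderiv ℝ f ξ‖]; rfl

lemma gradient_eq_gradientWithin (hopen : IsOpen (G '' openCube d)) {ξ : E d}
    (hξ : ξ ∈ openCube d) : gradientWithin u (G '' cube d) (G ξ) = ∇ u (G ξ) := by
  have : G '' cube d ∈ 𝓝 (G ξ) := mem_of_superset (hopen.mem_nhds (mem_image_of_mem G hξ))
    (image_mono (openCube_subset_cube d))
  rw [gradientWithin, gradient, fderivWithin_of_mem_nhds this]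

/-- In this direction the default value 0 would spoil the bound, so differentiability of `u` has to
be established: the inverse of `G` is differentiable because it is continuous and the derivative of
`G` is invertible. -/
lemma norm_fderiv_le (ha : 0 < a) (hb : 0 ≤ b) (hj : IsProperCell Ξ j)
    (hG : IsBiLipschitz a b G) (hopen : IsOpen (G '' openCube d))
    (hg : ContDiff ℝ 1 g) (hGg : ∀ ξ ∈ relCell Ξ j, G ξ = g ξ)
    (hf : ContDiff ℝ 1 f) (huf : ∀ ξ ∈ relCell Ξ j, u (G ξ) = f ξ) {ξ : E d}
    (hξ : ξ ∈ openCell Ξ j) :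
    ‖fderiv ℝ f ξ‖ ≤ b * ‖∇ u (G ξ)‖ := by
  rw [norm_gradient]
  have hξo := openCell_subset_openCube j hξ
  have hξc := openCube_subset_cube d hξo
  have hξr := openCell_subset_relCell j hξ
  have hnhds := nhds_relCell_of_mem_openCell hξ
  have hGn : G '' cube d ∈ 𝓝 (G ξ) := mem_of_superset (hopen.mem_nhds (mem_image_of_mem G hξo))
    (image_mono (openCube_subset_cube d))
  have hT := fderiv_bounds hb hj hG hg hGg (relCell_subset_closedCell j hξr)
  have hinj : Function.Injective (fderiv ℝ g ξ).toLinearMap := by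
    rw [← LinearMap.ker_eq_bot, LinearMap.ker_eq_bot']
    intro w hw
    have h4 := (hT w).1
    have hw : fderiv ℝ g ξ w = 0 := hw
    rw [hw, norm_zero] at h4
    exact norm_eq_zero.1 (le_antisymm (nonpos_of_mul_nonpos_right h4 ha) (norm_nonneg _))
  let T : E d ≃L[ℝ] E d := (LinearEquiv.ofInjectiveEndo _ hinj).toContinuousLinearEquiv
  have hTeq : (T : E d →L[ℝ] E d) = fderiv ℝ g ξ := by ext w; rfl
  have hGd : HasFDerivAt G (T : E d →L[ℝ] E d) ξ := by
    rw [hTeq]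
    exact (hg.differentiable one_ne_zero ξ).hasFDerivAt.congr_of_eventuallyEq
      (by filter_upwards [hnhds] with y hy using hGg y hy)
  have hinv := hG.invFunOn_apply ha hξc
  have hInv : HasFDerivAt (Function.invFunOn G (cube d)) (T.symm : E d →L[ℝ] E d) (G ξ) := by
    refine HasFDerivAt.of_local_left_inverse (f := G)
      ((hG.lipschitzOnWith_inv ha).continuousOn.continuousAt hGn) (by rwa [hinv]) ?_
    filter_upwards [hGn] with y hy using Function.invFunOn_eq hy
  have hcomp : HasFDerivAt (f ∘ Function.invFunOn G (cube d))
      ((fderiv ℝ f ξ).comp (T.symm : E d →L[ℝ] E d)) (G ξ) := by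
    refine HasFDerivAt.comp _ ?_ hInv
    rw [hinv]
    exact (hf.differentiable one_ne_zero ξ).hasFDerivAt
  have hu : HasFDerivAt u ((fderiv ℝ f ξ).comp (T.symm : E d →L[ℝ] E d)) (G ξ) := by
    refine hcomp.congr_of_eventuallyEq ?_
    have h7 : Function.invFunOn G (cube d) ⁻¹' relCell Ξ j ∈ 𝓝 (G ξ) :=
      hInv.continuousAt.preimage_mem_nhds (by rwa [hinv])
    filter_upwards [h7, hGn] with y hy hy'
    rw [Function.comp_apply, ← huf _ hy, Function.invFunOn_eq hy']
  rw [hu.fderiv]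
  refine ContinuousLinearMap.opNorm_le_bound _ (by positivity) fun w => ?_
  have h8 : fderiv ℝ f ξ w = ((fderiv ℝ f ξ).comp (T.symm : E d →L[ℝ] E d)) (T w) := by simp
  rw [h8]
  refine (ContinuousLinearMap.le_opNorm _ _).trans ?_
  have h9 : ‖T w‖ ≤ b * ‖w‖ := (hT w).2
  calc _ ≤ ‖(fderiv ℝ f ξ).comp (T.symm : E d →L[ℝ] E d)‖ * (b * ‖w‖) := by gcongr
    _ = _ := by ring

end Cell

section Cell

variable {d : ℕ} {Ξ : Fin d → KnotVector} {j : Fin d → ℕ} {a b : ℝ} {G g : E d → E d}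
  {u f : E d → ℝ}

lemma integral_norm_fderiv_sq_le (ha : 0 < a) (hb : 0 ≤ b) (hj : IsProperCell Ξ j)
    (hG : IsBiLipschitz a b G) (hopen : IsOpen (G '' openCube d))
    (hg : ContDiff ℝ 1 g) (hGg : ∀ ξ ∈ relCell Ξ j, G ξ = g ξ)
    (hf : ContDiff ℝ 1 f) (huf : ∀ ξ ∈ relCell Ξ j, u (G ξ) = f ξ)
    (hint : IntegrableOn (fun x => ‖∇ u x‖ ^ 2) (G '' openCell Ξ j)) :
    ∫ ξ in closedCell Ξ j, ‖fderiv ℝ f ξ‖ ^ 2 ≤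
      b ^ 2 * a⁻¹ ^ d * ∫ x in G '' openCell Ξ j, ‖∇ u x‖ ^ 2 := by
  have hcube : openCell Ξ j ⊆ cube d :=
    (openCell_subset_relCell j).trans (relCell_subset_cube j)
  have hm : MeasurableSet (openCell Ξ j) := (isOpen_openCell j).measurableSet
  have hae : closedCell Ξ j =ᵐ[volume] openCell Ξ j := by
    refine (ae_eq_of_subset_of_measure_ge (box_subset_closedBox _ _) ?_ hm.nullMeasurableSet
      (isCompact_closedBox _ _).measure_lt_top.ne).symm
    rw [volume_box, volume_closedBox]
  have hcont : Continuous fun ξ => ‖fderiv ℝ f ξ‖ ^ 2 := (hf.continuous_fderiv one_ne_zero).norm.pow 2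
  have hfint : IntegrableOn (fun ξ => ‖fderiv ℝ f ξ‖ ^ 2) (openCell Ξ j) :=
    (hcont.continuousOn.integrableOn_compact (isCompact_closedBox _ _)).mono_set
      (box_subset_closedBox _ _)
  have hI : 0 ≤ ∫ x in G '' openCell Ξ j, ‖∇ u x‖ ^ 2 := integral_nonneg fun _ => sq_nonneg _
  rw [setIntegral_congr_set hae, ← ENNReal.ofReal_le_ofReal_iff (by positivity),
    ofReal_integral_eq_lintegral_ofReal hfint (.of_forall fun _ => sq_nonneg _),
    ENNReal.ofReal_mul (by positivity), ENNReal.ofReal_mul (by positivity),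
    ofReal_integral_eq_lintegral_ofReal hint (.of_forall fun _ => sq_nonneg _)]
  have hF : Measurable fun x => ENNReal.ofReal (‖∇ u x‖ ^ 2) :=
    ((measurable_norm_gradient u).pow_const 2).ennreal_ofReal
  calc ∫⁻ ξ in openCell Ξ j, ENNReal.ofReal (‖fderiv ℝ f ξ‖ ^ 2)
      ≤ ∫⁻ ξ in openCell Ξ j, ENNReal.ofReal (b ^ 2) * ENNReal.ofReal (‖∇ u (G ξ)‖ ^ 2) := by
        refine setLIntegral_mono' hm fun ξ hξ => ?_
        rw [← ENNReal.ofReal_mul (sq_nonneg b), ← mul_pow]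
        gcongr
        exact norm_fderiv_le ha hb hj hG hopen hg hGg hf huf hξ
    _ = ENNReal.ofReal (b ^ 2) * ∫⁻ ξ in openCell Ξ j, ENNReal.ofReal (‖∇ u (G ξ)‖ ^ 2) :=
        lintegral_const_mul' _ _ ENNReal.ofReal_ne_top
    _ ≤ ENNReal.ofReal (b ^ 2) * (ENNReal.ofReal a⁻¹ ^ d *
          ∫⁻ x in G '' openCell Ξ j, ENNReal.ofReal (‖∇ u x‖ ^ 2)) := by
        gcongr
        exact hG.lintegral_comp_le ha hm hcube hF
    _ = _ := by rw [ENNReal.ofReal_pow (inv_pos.2 ha).le, mul_assoc]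

/-- The gradient of `u` is not polynomial, but the partial derivatives of its pull-back `f` are. The
inverse estimate is applied to these, between a passage from the patch to the cell and one back. -/
lemma prod_mul_norm_gradientWithin_sq_le {p : ℕ} {C : ℝ} (hC : 0 ≤ C)
    (HC : ∀ f ∈ tensorPoly d p, ∀ a b : Fin d → ℝ, (∀ ι, a ι < b ι) → ∀ x ∈ closedBox a b,
      (∏ ι, (b ι - a ι)) * f x ^ 2 ≤ C * ∫ y in closedBox a b, f y ^ 2)
    (ha : 0 < a) (hb : 0 ≤ b) (hj : IsProperCell Ξ j)
    (hG : IsBiLipschitz a b G) (hopen : IsOpen (G '' openCube d))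
    (hg : ContDiff ℝ 1 g) (hGg : ∀ ξ ∈ relCell Ξ j, G ξ = g ξ)
    (hfp : f ∈ tensorPoly d p) (huf : ∀ ξ ∈ relCell Ξ j, u (G ξ) = f ξ)
    (hint : IntegrableOn (fun x => ‖∇ u x‖ ^ 2) (G '' openCell Ξ j)) {ξ : E d}
    (hξ : ξ ∈ relCell Ξ j) :
    (∏ ι, (cellUpper Ξ j ι - cellLower Ξ j ι)) * ‖gradientWithin u (G '' cube d) (G ξ)‖ ^ 2 ≤
      a⁻¹ ^ 2 * (C * d * (b ^ 2 * a⁻¹ ^ d * ∫ x in G '' openCell Ξ j, ‖∇ u x‖ ^ 2)) := by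
  have hf := contDiff_of_mem_tensorPoly hfp
  have hpos : 0 < ∏ ι, (cellUpper Ξ j ι - cellLower Ξ j ι) :=
    Finset.prod_pos fun ι _ => sub_pos.2 (hj ι)
  have hcontD : Continuous fun ξ => ‖fderiv ℝ f ξ‖ ^ 2 :=
    (hf.continuous_fderiv one_ne_zero).norm.pow 2
  have h1 := norm_gradientWithin_le ha hb hj hG hg hGg hf huf hξ
  have h2 : ∀ i, (∏ ι, (cellUpper Ξ j ι - cellLower Ξ j ι)) *
      fderiv ℝ f ξ (EuclideanSpace.single i 1) ^ 2 ≤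
      C * ∫ y in closedCell Ξ j, ‖fderiv ℝ f y‖ ^ 2 := fun i => by
    refine (HC _ (fderiv_apply_mem_tensorPoly hfp i) _ _ hj ξ
      (relCell_subset_closedCell j hξ)).trans ?_
    gcongr
    refine integral_mono_of_nonneg (.of_forall fun _ => sq_nonneg _)
      (hcontD.continuousOn.integrableOn_compact (isCompact_closedBox _ _)) (.of_forall fun y => ?_)
    have := (fderiv ℝ f y).le_opNorm (EuclideanSpace.single i 1)
    simp only [PiLp.norm_single, norm_one, mul_one] at this
    show fderiv ℝ f y (EuclideanSpace.single i 1) ^ 2 ≤ ‖fderiv ℝ f y‖ ^ 2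
    rw [← sq_abs]
    exact pow_le_pow_left₀ (abs_nonneg _) this 2
  have h3 := integral_norm_fderiv_sq_le ha hb hj hG hopen hg hGg hf huf hint
  calc (∏ ι, (cellUpper Ξ j ι - cellLower Ξ j ι)) * ‖gradientWithin u (G '' cube d) (G ξ)‖ ^ 2
      ≤ (∏ ι, (cellUpper Ξ j ι - cellLower Ξ j ι)) *
          (a⁻¹ ^ 2 * ∑ i, fderiv ℝ f ξ (EuclideanSpace.single i 1) ^ 2) := by
        gcongr
        refine (pow_le_pow_left₀ (norm_nonneg _) h1 2).trans ?_
        rw [mul_pow]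
        gcongr
        exact norm_sq_le_sum_sq _
    _ = a⁻¹ ^ 2 * ∑ i, (∏ ι, (cellUpper Ξ j ι - cellLower Ξ j ι)) *
          fderiv ℝ f ξ (EuclideanSpace.single i 1) ^ 2 := by
        rw [← Finset.mul_sum]; ring
    _ ≤ a⁻¹ ^ 2 * ∑ _i : Fin d, C * ∫ y in closedCell Ξ j, ‖fderiv ℝ f y‖ ^ 2 := by
        exact mul_le_mul_of_nonneg_left (Finset.sum_le_sum fun i _ => h2 i) (by positivity)
    _ = a⁻¹ ^ 2 * (C * d * ∫ y in closedCell Ξ j, ‖fderiv ℝ f y‖ ^ 2) := by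
        rw [Finset.sum_const, Finset.card_univ, Fintype.card_fin, nsmul_eq_mul]; ring
    _ ≤ _ := by gcongr

end Cell

/-! ### Null sets of the mesh and the surface measure of boundary pieces -/

/-- The mesh cells with nonempty interior, as a finite set. -/
noncomputable def properCells {d : ℕ} (Ξ : Fin d → KnotVector) : Finset (Fin d → ℕ) :=
  open Classical in
  (Fintype.piFinset fun ι => Finset.range (Ξ ι).num).filter (IsProperCell Ξ)

lemma mem_properCells {d : ℕ} {Ξ : Fin d → KnotVector} {j : Fin d → ℕ} :
    j ∈ properCells Ξ ↔ IsProperCell Ξ j := by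
  simp only [properCells, Finset.mem_filter, Fintype.mem_piFinset, Finset.mem_range,
    and_iff_right_iff_imp]
  exact fun h ι => (Ξ ι).lt_num (h ι)

lemma relCell_inter_openCube_subset {d : ℕ} {Ξ : Fin d → KnotVector} (j : Fin d → ℕ) :
    relCell Ξ j ∩ openCube d ⊆ openCell Ξ j := by
  rintro ξ ⟨h, h'⟩ ι
  obtain ⟨-, h1, h2⟩ := h ι
  obtain ⟨h3, h4⟩ := h' ι
  constructor
  · show (Ξ ι).knot (j ι) < ξ ι
    split_ifs at h1 <;> linarith
  · show ξ ι < (Ξ ι).knot (j ι + 1)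
    split_ifs at h2 <;> linarith

lemma volume_openCube_diff_cells {d : ℕ} (Ξ : Fin d → KnotVector) :
    volume (openCube d \ ⋃ j ∈ properCells Ξ, openCell Ξ j) = 0 := by
  refine measure_mono_null (t := ⋃ (ι : Fin d) (i : ℕ), {ξ : E d | ξ ι = (Ξ ι).knot i}) ?_ ?_
  · rintro ξ ⟨h, h'⟩
    simp only [mem_iUnion, mem_properCells, not_exists] at h' ⊢
    rcases exists_relCell_or_knot (Ξ := Ξ) (openCube_subset_cube d h) with ⟨j, hj, hj'⟩ | ⟨ι, i, hi, -⟩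
    · exact absurd (relCell_inter_openCube_subset j ⟨hj', h⟩) (h' j hj)
    · exact ⟨ι, i, hi⟩
  · exact measure_iUnion_null fun ι => measure_iUnion_null fun i => volume_coord_eq ι _

/-- On a side the fixed coordinate is 0 or 1, while an exceptional coordinate is a knot strictly
between. The two are therefore different, and what is omitted lies in countably many slices of
codimension two. -/
lemma euclideanHausdorffMeasure_cubeBoundary_diff_cells {n : ℕ} (Ξ : Fin (n + 1) → KnotVector) :
    μHE[n] (cubeBoundary (n + 1) \ ⋃ j ∈ properCells Ξ, relCell Ξ j) = 0 := by
  refine measure_mono_null (t := ⋃ (ι : Fin (n + 1)) (t : Bool) (ι' : Fin (n + 1)) (_ : ι' ≠ ι)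
    (i : ℕ), {ξ : E (n + 1) | ξ ι = (if t then 1 else 0) ∧ ξ ι' = (Ξ ι').knot i}) ?_ ?_
  · rintro ξ ⟨h, h'⟩
    simp only [cubeBoundary, mem_iUnion, mem_properCells, not_exists] at h h' ⊢
    obtain ⟨ι, t, hξ, ht⟩ := h
    rcases exists_relCell_or_knot (Ξ := Ξ) hξ with ⟨j, hj, hj'⟩ | ⟨ι', i, hi, hi'⟩
    · exact absurd hj' (h' j hj)
    · refine ⟨ι, t, ι', ?_, i, ht, hi⟩
      rintro rfl
      rw [ht] at hi'
      cases t <;> simp at hi'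
  · refine measure_iUnion_null fun ι => measure_iUnion_null fun t => measure_iUnion_null fun ι' =>
      measure_iUnion_null fun h => measure_iUnion_null fun i => ?_
    exact euclideanHausdorffMeasure_face_slice h _ _

/-- All faces of the cell are counted, whether or not they lie on the boundary of the cube; the 2
accounts for opposite sides. -/
lemma euclideanHausdorffMeasure_relCell_inter_boundary_le {n : ℕ} {Ξ : Fin (n + 1) → KnotVector}
    {j : Fin (n + 1) → ℕ} (hj : IsProperCell Ξ j) :
    μHE[n] (relCell Ξ j ∩ cubeBoundary (n + 1)) ≤ ENNReal.ofReal
      (∑ ι : Fin (n + 1), 2 * ∏ k : Fin n, (cellUpper Ξ j (ι.succAbove k) -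
        cellLower Ξ j (ι.succAbove k))) := by
  have hsub : relCell Ξ j ∩ cubeBoundary (n + 1) ⊆ ⋃ (ι : Fin (n + 1)), ⋃ (t : Bool),
      {ξ ∈ closedCell Ξ j | ξ ι = if t then 1 else 0} := by
    rintro ξ ⟨h, h'⟩
    simp only [cubeBoundary, mem_iUnion] at h' ⊢
    obtain ⟨ι, t, h1, h2⟩ := h'
    exact ⟨ι, t, relCell_subset_closedCell j h, h2⟩
  have hnn : ∀ ι, 0 ≤ cellUpper Ξ j ι - cellLower Ξ j ι := fun ι => (sub_pos.2 (hj ι)).le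
  refine (measure_mono hsub).trans ((measure_iUnion_fintype_le _ _).trans ?_)
  rw [ENNReal.ofReal_sum_of_nonneg fun ι _ =>
    mul_nonneg two_pos.le (Finset.prod_nonneg fun k _ => hnn _)]
  refine Finset.sum_le_sum fun ι _ => (measure_iUnion_fintype_le _ _).trans ?_
  rw [ENNReal.ofReal_mul two_pos.le, ENNReal.ofReal_prod_of_nonneg fun k _ => hnn _,
    ENNReal.ofReal_ofNat, two_mul, Fintype.sum_bool]
  gcongr <;> exact euclideanHausdorffMeasure_face ι _ _ _

/-! ### Patches -/

namespace Patch

variable {d : ℕ} {K : Patch d} {κ θ : ℝ}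

lemma IsShapeRegular.isBiLipschitz (h : K.IsShapeRegular κ) :
    IsBiLipschitz (κ⁻¹ * K.diam) (κ * K.diam) K.G := h

lemma diam_nonneg : 0 ≤ K.diam := Metric.diam_nonneg

lemma diam_pos [NeZero d] (h : K.IsShapeRegular κ) : 0 < K.diam := by
  refine lt_of_le_of_ne diam_nonneg fun h0 => ?_
  have hx : (0 : E d) ∈ cube d := fun ι => by simp
  have hy : (WithLp.toLp 2 fun _ => 1 : E d) ∈ cube d := fun ι => by simp
  have h1 := (h _ hx _ hy).2
  rw [← h0, mul_zero, zero_mul] at h1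
  have h2 := K.injOn hx hy (sub_eq_zero.1 (norm_eq_zero.1 (le_antisymm h1 (norm_nonneg _))))
  have h3 := congrArg (fun z : E d => z 0) h2
  simp at h3

lemma isOpen_dom : IsOpen K.dom := K.isOpen_image

lemma dom_subset_closedDom : K.dom ⊆ K.closedDom := image_mono (openCube_subset_cube d)

lemma isCompact_closedDom (h : K.IsShapeRegular κ) : IsCompact K.closedDom :=
  (isCompact_cube d).image_of_continuousOn h.isBiLipschitz.continuousOn

lemma closedDom_subset_closure_dom (h : K.IsShapeRegular κ) : K.closedDom ⊆ closure K.dom := by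
  rw [closedDom, ← closure_openCube]
  refine ContinuousOn.image_closure ?_
  rw [closure_openCube]
  exact h.isBiLipschitz.continuousOn

lemma exists_contDiff_eq_G {j : Fin d → ℕ} (hj : IsProperCell K.Ξ j) :
    ∃ g : E d → E d, ContDiff ℝ 1 g ∧ ∀ ξ ∈ relCell K.Ξ j, K.G ξ = g ξ := by
  obtain ⟨p, hp⟩ : ∃ p, ∀ ι, (K.Ξ ι).deg ≤ p :=
    ⟨∑ ι, (K.Ξ ι).deg, fun ι => Finset.single_le_sum (f := fun ι => (K.Ξ ι).deg)
      (fun _ _ => Nat.zero_le _) (Finset.mem_univ ι)⟩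
  choose f hf hf' using fun ι : Fin d => exists_mem_tensorPoly hp hj fun i => K.P i ι
  refine ⟨fun ξ => WithLp.toLp 2 fun ι => f ι ξ, ?_, fun ξ hξ => ?_⟩
  · exact contDiff_euclidean.2 fun ι => contDiff_of_mem_tensorPoly (hf ι)
  · ext ι
    show (K.G ξ) ι = f ι ξ
    rw [← hf' ι ξ hξ]
    simp [G, geoMap, spline, mul_comm]

lemma exists_eq_spline {u : E d → ℝ} (hu : u ∈ K.space) : ∃ c : (∀ ι, Fin (K.Ξ ι).num) → ℝ,
    ∀ ξ ∈ cube d, u (K.G ξ) = spline K.Ξ c ξ := by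
  obtain ⟨c, rfl⟩ := (Submodule.mem_span_range_iff_exists_fun ℝ).1 hu
  refine ⟨c, fun ξ hξ => ?_⟩
  have h : Function.invFunOn K.G (cube d) (K.G ξ) = ξ := K.injOn.leftInvOn_invFunOn hξ
  have h' : K.G ξ ∈ K.closedDom := mem_image_of_mem _ hξ
  simp [Finset.sum_apply, basisFun, spline, indicator_of_mem h', h]

lemma aestronglyMeasurable_of_mem_space [NeZero d] (hκ : 0 < κ) (h : K.IsShapeRegular κ)
    {u : E d → ℝ} (hu : u ∈ K.space) (μ : Measure (E d)) : AEStronglyMeasurable u μ := by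
  have ha : 0 < κ⁻¹ * K.diam := mul_pos (inv_pos.2 hκ) (diam_pos h)
  have hm := (isCompact_closedDom h).measurableSet
  induction hu using Submodule.span_induction with
  | mem u hu =>
    obtain ⟨i, rfl⟩ := hu
    refine AEMeasurable.aestronglyMeasurable ?_
    rw [basisFun, aemeasurable_indicator_iff hm]
    exact (measurable_tensorBSpline i).comp_aemeasurable
      ((h.isBiLipschitz.lipschitzOnWith_inv ha).continuousOn.aemeasurable hm)
  | zero => exact aestronglyMeasurable_const
  | add u v _ _ hu hv => exact hu.add hv
  | smul c u _ hu => exact hu.const_smul c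

lemma bounded_of_mem_space {u : E d → ℝ} (hu : u ∈ K.space) : ∃ C, ∀ x, |u x| ≤ C := by
  induction hu using Submodule.span_induction with
  | mem u hu =>
    obtain ⟨i, rfl⟩ := hu
    obtain ⟨C, hC⟩ := tensorBSpline_bounded i
    refine ⟨max C 0, fun x => ?_⟩
    by_cases hx : x ∈ K.closedDom
    · rw [basisFun, indicator_of_mem hx]
      exact (hC _ (Function.invFunOn_mem hx)).trans (le_max_left _ _)
    · simp [basisFun, indicator_of_notMem hx]
  | zero => exact ⟨0, fun x => by simp⟩
  | add u v _ _ hu hv =>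
    obtain ⟨C, hC⟩ := hu
    obtain ⟨C', hC'⟩ := hv
    exact ⟨C + C', fun x => (abs_add_le _ _).trans (add_le_add (hC x) (hC' x))⟩
  | smul c u _ hu =>
    obtain ⟨C, hC⟩ := hu
    exact ⟨|c| * C, fun x => by
      rw [Pi.smul_apply, smul_eq_mul, abs_mul]
      exact mul_le_mul_of_nonneg_left (hC x) (abs_nonneg c)⟩

/-- The gradient is bounded on each of the finitely many cells, which fill the patch up to a null
set. The size of the bound is irrelevant; without integrability the energy integral would be 0 by
default. -/
lemma integrableOn_norm_gradient_sq [NeZero d] (hκ : 0 < κ) (h : K.IsShapeRegular κ)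
    {u : E d → ℝ} (hu : u ∈ K.space) : IntegrableOn (fun x => ‖∇ u x‖ ^ 2) K.dom := by
  have ha : 0 < κ⁻¹ * K.diam := mul_pos (inv_pos.2 hκ) (diam_pos h)
  have hb : 0 ≤ κ * K.diam := mul_nonneg hκ.le diam_nonneg
  have hG := h.isBiLipschitz
  obtain ⟨c, hc⟩ := exists_eq_spline hu
  have hB : ∀ j : Fin d → ℕ, ∃ B : ℝ, 0 ≤ B ∧ (IsProperCell K.Ξ j →
      ∀ ξ ∈ openCell K.Ξ j, ‖∇ u (K.G ξ)‖ ≤ B) := fun j => by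
    by_cases hj : IsProperCell K.Ξ j
    swap
    · exact ⟨0, le_rfl, fun h => absurd h hj⟩
    obtain ⟨p, hp⟩ : ∃ p, ∀ ι, (K.Ξ ι).deg ≤ p :=
      ⟨∑ ι, (K.Ξ ι).deg, fun ι => Finset.single_le_sum (f := fun ι => (K.Ξ ι).deg)
        (fun _ _ => Nat.zero_le _) (Finset.mem_univ ι)⟩
    obtain ⟨g, hg, hg'⟩ := exists_contDiff_eq_G hj
    obtain ⟨f, hf, hf'⟩ := exists_mem_tensorPoly hp hj c
    have hfc := contDiff_of_mem_tensorPoly hf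
    obtain ⟨B, hB⟩ := (isCompact_cube d).exists_bound_of_continuousOn
      (hfc.continuous_fderiv one_ne_zero).continuousOn
    refine ⟨(κ⁻¹ * K.diam)⁻¹ * max B 0, by positivity, fun _ ξ hξ => ?_⟩
    have hξr := openCell_subset_relCell j hξ
    rw [← gradient_eq_gradientWithin (G := K.G) K.isOpen_image (openCell_subset_openCube j hξ)]
    refine (norm_gradientWithin_le ha hb hj hG hg hg' hfc
      (fun η hη => (hc η (relCell_subset_cube j hη)).trans (hf' η hη)) hξr).trans ?_
    gcongr
    exact (hB ξ (relCell_subset_cube j hξr)).trans (le_max_left _ _)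
  choose B hB0 hB using hB
  have hnull : volume (K.G '' (openCube d \ ⋃ j ∈ properCells K.Ξ, openCell K.Ξ j)) = 0 := by
    have := hG.volume_image_le
      (sdiff_subset.trans (openCube_subset_cube d) :
        openCube d \ ⋃ j ∈ properCells K.Ξ, openCell K.Ξ j ⊆ cube d)
    rw [volume_openCube_diff_cells, mul_zero] at this
    exact nonpos_iff_eq_zero.1 this
  have hfin : volume K.dom < ⊤ :=
    (measure_mono dom_subset_closedDom).trans_lt (isCompact_closedDom h).measure_lt_top
  refine IntegrableOn.of_bound hfin
    ((measurable_norm_gradient u).pow_const 2).aestronglyMeasurable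
    ((∑ j ∈ properCells K.Ξ, B j) ^ 2) ?_
  rw [ae_restrict_iff' isOpen_dom.measurableSet]
  filter_upwards [compl_mem_ae_iff.2 hnull] with x hx hxd
  obtain ⟨ξ, hξ, rfl⟩ := hxd
  have hmem : ξ ∈ ⋃ j ∈ properCells K.Ξ, openCell K.Ξ j := by
    by_contra hn
    exact hx (mem_image_of_mem _ ⟨hξ, hn⟩)
  simp only [mem_iUnion] at hmem
  obtain ⟨j, hj, hjξ⟩ := hmem
  rw [norm_pow, norm_norm]
  gcongr
  exact (hB j (mem_properCells.1 hj) ξ hjξ).trans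
    (Finset.single_le_sum (fun j _ => hB0 j) hj)

end Patch

lemma norm_le_of_forall_abs_le {d : ℕ} {x : E d} {m : ℝ} (h : ∀ ι, |x ι| ≤ m) :
    ‖x‖ ≤ d * m := by
  have hx : x = ∑ i, x i • EuclideanSpace.single i (1 : ℝ) := by
    simpa using ((EuclideanSpace.basisFun (Fin d) ℝ).sum_repr x).symm
  calc ‖x‖ = ‖∑ i, x i • EuclideanSpace.single i (1 : ℝ)‖ := congrArg norm hx
    _ ≤ ∑ i, ‖x i • EuclideanSpace.single i (1 : ℝ)‖ := norm_sum_le _ _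
    _ ≤ ∑ _i : Fin d, m := Finset.sum_le_sum fun i _ => by simpa [norm_smul] using h i
    _ = d * m := by simp

lemma abs_apply_le_norm {d : ℕ} (x : E d) (ι : Fin d) : |x ι| ≤ ‖x‖ :=
  PiLp.norm_apply_le x ι

namespace Patch

variable {d : ℕ} {K : Patch d} {κ θ : ℝ}

lemma cell_subset_cube (j : ∀ ι, Fin ((K.Ξ ι).num + (K.Ξ ι).deg)) : K.cell j ⊆ cube d :=
  fun _ h ι => ⟨((K.Ξ ι).knot_nonneg _).trans (h ι).1, (h ι).2.trans ((K.Ξ ι).knot_le_one _)⟩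

lemma meshSize_nonneg : 0 ≤ K.meshSize := Real.iSup_nonneg fun _ => Metric.diam_nonneg

/-- This is where quasi-uniformity enters: any side of any proper cell controls the diameters of all
cells. -/
lemma meshSize_le (hκ : 0 ≤ κ) (hθ : 0 ≤ θ) (h : K.IsShapeRegular κ) (hq : K.IsQuasiUniform θ)
    {j : Fin d → ℕ} (hj : IsProperCell K.Ξ j) (ι : Fin d) :
    K.meshSize ≤ κ * K.diam * (d * (θ * (cellUpper K.Ξ j ι - cellLower K.Ξ j ι))) := by
  have hℓ : 0 ≤ cellUpper K.Ξ j ι - cellLower K.Ξ j ι := (sub_pos.2 (hj ι)).le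
  have hH : 0 ≤ K.diam := diam_nonneg
  refine Real.iSup_le (fun i => ?_) (by positivity)
  refine Metric.diam_le_of_forall_dist_le (by positivity) ?_
  rintro _ ⟨ξ, hξ, rfl⟩ _ ⟨η, hη, rfl⟩
  rw [dist_eq_norm]
  refine (h ξ (cell_subset_cube i hξ) η (cell_subset_cube i hη)).2.trans ?_
  gcongr
  refine norm_le_of_forall_abs_le fun ι' => ?_
  have h1 := hq ι' ι (i ι') (j ι) (hj ι)
  refine le_trans ?_ h1
  rw [PiLp.sub_apply, abs_le]
  constructor <;> linarith [(hξ ι').1, (hξ ι').2, (hη ι').1, (hη ι').2]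

lemma meshSize_pos [NeZero d] (h : K.IsShapeRegular κ) : 0 < K.meshSize := by
  choose j hj using fun ι => (K.Ξ ι).exists_knot_lt
  let i : ∀ ι, Fin ((K.Ξ ι).num + (K.Ξ ι).deg) := fun ι =>
    ⟨j ι, ((K.Ξ ι).lt_num (hj ι)).trans_le (Nat.le_add_right _ _)⟩
  have hx : (WithLp.toLp 2 (cellLower K.Ξ j) : E d) ∈ K.cell i := fun ι => ⟨le_rfl, (hj ι).le⟩
  have hy : (WithLp.toLp 2 (cellUpper K.Ξ j) : E d) ∈ K.cell i := fun ι => ⟨(hj ι).le, le_rfl⟩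
  have hne : K.G (WithLp.toLp 2 (cellLower K.Ξ j)) ≠ K.G (WithLp.toLp 2 (cellUpper K.Ξ j)) := by
    intro heq
    have h2 := K.injOn (cell_subset_cube i hx) (cell_subset_cube i hy) heq
    exact (hj 0).ne (congrArg (fun z : E d => z 0) h2)
  have hbd : Bornology.IsBounded (K.G '' K.cell i) :=
    (isCompact_closedDom h).isBounded.subset (image_mono (cell_subset_cube i))
  calc 0 < dist _ _ := dist_pos.2 hne
    _ ≤ Metric.diam (K.G '' K.cell i) :=
      Metric.dist_le_diam_of_mem hbd (mem_image_of_mem _ hx) (mem_image_of_mem _ hy)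
    _ ≤ K.meshSize := le_ciSup (f := fun i => Metric.diam (K.G '' K.cell i))
      (finite_range _).bddAbove i

/-- The boundary of the patch, as the union of its sides. -/
def boundary (K : Patch d) : Set (E d) := K.G '' cubeBoundary d

lemma isCompact_boundary (h : K.IsShapeRegular κ) : IsCompact K.boundary :=
  (isCompact_cubeBoundary d).image_of_continuousOn
    (h.isBiLipschitz.continuousOn.mono (cubeBoundary_subset_cube d))

lemma euclideanHausdorffMeasure_boundary_lt_top {n : ℕ} {K : Patch (n + 1)}
    (h : K.IsShapeRegular κ) : μHE[n] K.boundary < ⊤ := by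
  refine (euclideanHausdorffMeasure_image_le
    (h.isBiLipschitz.lipschitzOnWith.mono (cubeBoundary_subset_cube _)) n).trans_lt ?_
  refine ENNReal.mul_lt_top (ENNReal.pow_lt_top ENNReal.coe_lt_top) ?_
  refine (measure_iUnion_fintype_le _ _).trans_lt (ENNReal.sum_lt_top.2 fun ι _ =>
    (measure_iUnion_fintype_le _ _).trans_lt (ENNReal.sum_lt_top.2 fun b _ => ?_))
  exact (euclideanHausdorffMeasure_face ι (if b then 1 else 0) 0 1).trans_lt
    (ENNReal.prod_lt_top fun _ _ => ENNReal.ofReal_lt_top)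

/-- Discrete trace inequality: the square of the gradient on the patch boundary has an integrable
majorant whose integral is bounded by the energy on the patch divided by the mesh size. -/
lemma exists_trace_bound (n p : ℕ) {κ θ : ℝ} (hκ : 0 < κ) (hθ : 0 < θ) : ∃ C : ℝ, 0 < C ∧
    ∀ K : Patch (n + 1), (∀ ι, (K.Ξ ι).deg ≤ p) → K.IsShapeRegular κ → K.IsQuasiUniform θ →
    ∀ u ∈ K.space, ∃ g : E (n + 1) → ℝ, (∀ x, 0 ≤ g x) ∧ IntegrableOn g K.boundary μHE[n] ∧
      (∀ᵐ x ∂(μHE[n]).restrict K.boundary, ‖gradientWithin u K.closedDom x‖ ^ 2 ≤ g x) ∧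
      K.meshSize * ∫ x in K.boundary, g x ∂μHE[n] ≤ C * ∫ x in K.dom, ‖∇ u x‖ ^ 2 := by
  obtain ⟨C, hC, HC⟩ := exists_sq_le_integral_closedBox (n + 1) p
  -- The factors come from the inverse estimate for `n + 1` partial derivatives, from `meshSize_le`,
  -- and from the `2 * (n + 1)` faces of a cell. The power of `κ ^ 2 = b * a⁻¹` collects `b ^ n`
  -- (surface), `b` (mesh size) and `a⁻¹ ^ 2 * b ^ 2 * a⁻¹ ^ (n + 1)` (gradients and volume); the
  -- patch diameter cancels.
  refine ⟨C * (n + 1 : ℕ) * (κ ^ 2) ^ (n + 3) * ((n + 1 : ℕ) * θ) * (2 * (n + 1 : ℕ)),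
    by positivity, fun K hp h hq u hu => ?_⟩
  have hH := diam_pos h
  set a := κ⁻¹ * K.diam with ha_def
  set b := κ * K.diam with hb_def
  have ha : 0 < a := by positivity
  have hb : 0 < b := by positivity
  have hG : IsBiLipschitz a b K.G := h
  obtain ⟨c, hc⟩ := exists_eq_spline hu
  have hint := integrableOn_norm_gradient_sq hκ h hu
  have hcelldom : ∀ j, K.G '' openCell K.Ξ j ⊆ K.dom := fun j =>
    image_mono (openCell_subset_openCube j)
  let I : (Fin (n + 1) → ℕ) → ℝ := fun j => ∫ x in K.G '' openCell K.Ξ j, ‖∇ u x‖ ^ 2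
  let V : (Fin (n + 1) → ℕ) → ℝ := fun j => ∏ ι, (cellUpper K.Ξ j ι - cellLower K.Ξ j ι)
  let A : (Fin (n + 1) → ℕ) → Set (E (n + 1)) := fun j =>
    K.G '' (relCell K.Ξ j ∩ cubeBoundary (n + 1))
  let c₀ : ℝ := a⁻¹ ^ 2 * (C * (n + 1 : ℕ) * (b ^ 2 * a⁻¹ ^ (n + 1)))
  have hc₀ : 0 ≤ c₀ := by positivity
  have hI : ∀ j, 0 ≤ I j := fun j => integral_nonneg fun _ => sq_nonneg _
  have hV : ∀ j ∈ properCells K.Ξ, 0 < V j := fun j hj =>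
    Finset.prod_pos fun ι _ => sub_pos.2 (mem_properCells.1 hj ι)
  have hAm : ∀ j, MeasurableSet (A j) := fun j =>
    hG.measurableSet_image ha
      ((measurableSet_relCell j).inter (isCompact_cubeBoundary _).measurableSet)
      (inter_subset_left.trans (relCell_subset_cube j))
  have hAb : ∀ j, A j ⊆ K.boundary := fun j => image_mono inter_subset_right
  have hfin := euclideanHausdorffMeasure_boundary_lt_top h
  have : IsFiniteMeasure ((μHE[n]).restrict K.boundary) := ⟨by simpa using hfin⟩
  let M : (Fin (n + 1) → ℕ) → ℝ := fun j => c₀ * I j / V j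
  have hM : ∀ j ∈ properCells K.Ξ, 0 ≤ M j := fun j hj =>
    div_nonneg (mul_nonneg hc₀ (hI j)) (hV j hj).le
  -- A majorant that is constant on the boundary piece of each cell is plainly integrable, so
  -- measurability of the gradient on the boundary is never needed.
  refine ⟨fun x => ∑ j ∈ properCells K.Ξ, (A j).indicator (fun _ => M j) x, fun x => ?_, ?_, ?_, ?_⟩
  · exact Finset.sum_nonneg fun j hj => indicator_nonneg (fun _ _ => hM j hj) x
  · exact integrable_finsetSum _ fun j _ => (integrable_const _).indicator (hAm j)
  · have hnull : μHE[n] (K.G '' (cubeBoundary (n + 1) \ ⋃ j ∈ properCells K.Ξ, relCell K.Ξ j)) = 0 := by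
      have := euclideanHausdorffMeasure_image_le (hG.lipschitzOnWith.mono
        (sdiff_subset.trans (cubeBoundary_subset_cube _) :
          cubeBoundary (n + 1) \ ⋃ j ∈ properCells K.Ξ, relCell K.Ξ j ⊆ _)) n
      rw [euclideanHausdorffMeasure_cubeBoundary_diff_cells, mul_zero] at this
      exact nonpos_iff_eq_zero.1 this
    rw [ae_restrict_iff' (isCompact_boundary h).measurableSet]
    filter_upwards [compl_mem_ae_iff.2 hnull] with x hx hxb
    obtain ⟨ξ, hξ, rfl⟩ := hxb
    have hmem : ξ ∈ ⋃ j ∈ properCells K.Ξ, relCell K.Ξ j := by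
      by_contra hn
      exact hx (mem_image_of_mem _ ⟨hξ, hn⟩)
    simp only [mem_iUnion] at hmem
    obtain ⟨j, hj, hjξ⟩ := hmem
    have hjp := mem_properCells.1 hj
    obtain ⟨g, hg, hg'⟩ := exists_contDiff_eq_G hjp
    obtain ⟨f, hf, hf'⟩ := exists_mem_tensorPoly hp hjp c
    have key := prod_mul_norm_gradientWithin_sq_le hC.le HC ha hb.le hjp hG K.isOpen_image hg hg' hf
      (fun η hη => (hc η (relCell_subset_cube j hη)).trans (hf' η hη))
      (hint.mono_set (hcelldom j)) hjξ
    have hMj : ‖gradientWithin u K.closedDom (K.G ξ)‖ ^ 2 ≤ M j := by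
      rw [le_div_iff₀ (hV j hj), mul_comm]
      refine key.trans_eq ?_
      simp only [c₀, I]
      ring
    refine hMj.trans ?_
    have : (A j).indicator (fun _ => M j) (K.G ξ) = M j :=
      indicator_of_mem (show K.G ξ ∈ A j from ⟨ξ, ⟨hjξ, hξ⟩, rfl⟩) _
    rw [← this]
    exact Finset.single_le_sum (f := fun j => (A j).indicator (fun _ => M j) (K.G ξ))
      (fun j hj => indicator_nonneg (fun _ _ => hM j hj) _) hj
  · have hsum : ∑ j ∈ properCells K.Ξ, I j ≤ ∫ x in K.dom, ‖∇ u x‖ ^ 2 := by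
      rw [← integral_biUnion_finset]
      · refine setIntegral_mono_set hint (.of_forall fun _ => sq_nonneg _) ?_
        exact (iUnion₂_subset fun j _ => hcelldom j).eventuallyLE
      · exact fun j _ => hG.measurableSet_image ha (isOpen_openCell j).measurableSet
          ((openCell_subset_relCell j).trans (relCell_subset_cube j))
      · intro i _ j _ hij
        exact (disjoint_openCell hij).image K.injOn
          ((openCell_subset_relCell i).trans (relCell_subset_cube i))
          ((openCell_subset_relCell j).trans (relCell_subset_cube j))
      · exact fun j _ => hint.mono_set (hcelldom j)
    have hint2 : ∀ j ∈ properCells K.Ξ, Integrable ((A j).indicator fun _ => M j)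
        ((μHE[n]).restrict K.boundary) := fun j _ => (integrable_const _).indicator (hAm j)
    rw [integral_finsetSum _ hint2, Finset.mul_sum]
    refine (Finset.sum_le_sum (g := fun j => C * (n + 1 : ℕ) * (κ ^ 2) ^ (n + 3) *
      ((n + 1 : ℕ) * θ) * (2 * (n + 1 : ℕ)) * I j) fun j hj => ?_).trans ?_
    swap
    · rw [← Finset.mul_sum]
      gcongr
    have hjp := mem_properCells.1 hj
    set ℓ : Fin (n + 1) → ℝ := fun ι => cellUpper K.Ξ j ι - cellLower K.Ξ j ι with hℓ
    have hℓpos : ∀ ι, 0 < ℓ ι := fun ι => sub_pos.2 (hjp ι)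
    have hmeas : ((μHE[n]).restrict K.boundary).real (A j) ≤
        b ^ n * ∑ ι : Fin (n + 1), 2 * ∏ k : Fin n, ℓ (ι.succAbove k) := by
      have hnn : 0 ≤ ∑ ι : Fin (n + 1), 2 * ∏ k : Fin n, ℓ (ι.succAbove k) :=
        Finset.sum_nonneg fun ι _ => mul_nonneg two_pos.le
          (Finset.prod_nonneg fun k _ => (hℓpos _).le)
      refine ENNReal.toReal_le_of_le_ofReal (by positivity) ?_
      rw [Measure.restrict_apply (hAm j), inter_eq_left.2 (hAb j)]
      refine (euclideanHausdorffMeasure_image_le (hG.lipschitzOnWith.mono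
        (inter_subset_left.trans (relCell_subset_cube j))) n).trans ?_
      rw [ENNReal.ofReal_mul (by positivity), ENNReal.ofReal_pow hb.le]
      gcongr
      · exact le_rfl
      · exact euclideanHausdorffMeasure_relCell_inter_boundary_le hjp
    have hVι : ∀ ι : Fin (n + 1), ℓ ι * ∏ k : Fin n, ℓ (ι.succAbove k) = V j := fun ι =>
      (Fin.prod_univ_succAbove ℓ ι).symm
    rw [integral_indicator_const _ (hAm j), smul_eq_mul]
    have hMj := hM j hj
    calc K.meshSize * (((μHE[n]).restrict K.boundary).real (A j) * M j)
        ≤ K.meshSize * ((b ^ n * ∑ ι : Fin (n + 1), 2 * ∏ k : Fin n, ℓ (ι.succAbove k)) * M j) := by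
          gcongr
          exact meshSize_nonneg
      _ = b ^ n * M j * ∑ ι : Fin (n + 1), K.meshSize * (2 * ∏ k : Fin n, ℓ (ι.succAbove k)) := by
          rw [← Finset.mul_sum Finset.univ _ K.meshSize]; ring
      -- The mesh size supplies the edge length missing in the area of a face orthogonal to `ι`,
      -- which completes it to the volume of the cell.
      _ ≤ b ^ n * M j * ∑ _ι : Fin (n + 1), b * ((n + 1 : ℕ) * θ) * 2 * V j := by
          refine mul_le_mul_of_nonneg_left (Finset.sum_le_sum fun ι _ => ?_) (by positivity)
          have h1 := meshSize_le hκ.le hθ.le h hq hjp ι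
          have h2 : 0 ≤ ∏ k : Fin n, ℓ (ι.succAbove k) :=
            Finset.prod_nonneg fun k _ => (hℓpos _).le
          refine (mul_le_mul_of_nonneg_right h1 (by positivity)).trans_eq ?_
          rw [← hVι ι]
          simp only [hℓ, hb_def]
          ring
      _ = C * (n + 1 : ℕ) * (b * a⁻¹) ^ (n + 3) * ((n + 1 : ℕ) * θ) * (2 * (n + 1 : ℕ)) * I j := by
          have hMV : M j * V j = c₀ * I j := div_mul_cancel₀ _ (hV j hj).ne'
          rw [Finset.sum_const, Finset.card_univ, Fintype.card_fin, nsmul_eq_mul]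
          calc b ^ n * M j * ((n + 1 : ℕ) * (b * ((n + 1 : ℕ) * θ) * 2 * V j))
              = b ^ n * b * ((n + 1 : ℕ) * θ) * (2 * (n + 1 : ℕ)) * (M j * V j) := by ring
            _ = _ := by
              rw [hMV]
              simp only [c₀]
              ring
      _ = _ := by
          have : b * a⁻¹ = κ ^ 2 := by
            rw [ha_def, hb_def]; field_simp
          rw [this]

end Patch

/-! ### Interfaces of a multipatch domain -/

/-- The box has a corner at `ξ`; in each coordinate it extends towards the farther end of `[0,1]`,
where there is room for length 1/2. -/
lemma exists_box_near {d : ℕ} {ξ : E d} (hξ : ξ ∈ cube d) {s : ℝ} (hs' : s ≤ 1 / 2) :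
    ∃ a b : Fin d → ℝ, (∀ ι, b ι - a ι = s) ∧ box a b ⊆ openCube d ∧
      ∀ η ∈ box a b, ‖η - ξ‖ ≤ d * s := by
  refine ⟨fun ι => if ξ ι ≤ 1 / 2 then ξ ι else ξ ι - s,
    fun ι => if ξ ι ≤ 1 / 2 then ξ ι + s else ξ ι, fun ι => ?_, fun η hη ι => ?_, fun η hη => ?_⟩
  · beta_reduce
    split_ifs <;> ring
  · have h1 := hη ι
    have h2 := hξ ι
    simp only [mem_Ioo, mem_Icc] at h1 h2 ⊢
    split_ifs at h1 with h <;> constructor <;> linarith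
  · refine norm_le_of_forall_abs_le fun ι => ?_
    have h1 := hη ι
    simp only [mem_Ioo] at h1
    rw [PiLp.sub_apply, abs_le]
    split_ifs at h1 with h <;> constructor <;> linarith

namespace Multipatch

variable {d N : ℕ} {M : Multipatch d N} {κ : ℝ}

/-- Packing argument: every patch whose closure contains `x` has a part of volume at least a
multiple of `r ^ d` in the cube of side `2 * r` about `x`, and these parts are disjoint. -/
lemma card_closedDom_le [NeZero d] (hκ : 0 < κ) (h : ∀ k, (M.patch k).IsShapeRegular κ)
    (S : Finset (Fin N)) {x : E d} (hS : ∀ l ∈ S, x ∈ (M.patch l).closedDom) :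
    (S.card : ℝ) ≤ (2 * d * κ ^ 2) ^ d := by
  have hd : (0 : ℝ) < d := Nat.cast_pos.2 (NeZero.pos d)
  have hH : ∀ l, 0 < (M.patch l).diam := fun l => Patch.diam_pos (h l)
  -- One radius serves all patches, however different their sizes: it is so small that the box of
  -- side `s` below has `s ≤ 1 / 2`. It cancels in the end.
  obtain ⟨r, hr, hr0⟩ : ∃ r : ℝ, (∀ l, r ≤ κ * (M.patch l).diam * d / 2) ∧ 0 < r := by
    have h1 : ∀ᶠ r : ℝ in 𝓝[>] 0, ∀ l, r ≤ κ * (M.patch l).diam * d / 2 := by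
      refine eventually_all.2 fun l => ?_
      have : 0 < κ * (M.patch l).diam * d / 2 := by have := hH l; positivity
      exact nhdsWithin_le_nhds (Iic_mem_nhds this)
    exact (h1.and self_mem_nhdsWithin).exists
  have hbox : ∀ l ∈ S, ∃ A : Set (E d), MeasurableSet A ∧ A ⊆ (M.patch l).dom ∧
      A ⊆ closedBox (fun ι => x ι - r) (fun ι => x ι + r) ∧
      ENNReal.ofReal ((r / (κ ^ 2 * d)) ^ d) ≤ volume A := by
    intro l hl
    obtain ⟨ξ, hξ, hξx⟩ := hS l hl
    have hHl := hH l
    have hG := (h l).isBiLipschitz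
    have ha : 0 < κ⁻¹ * (M.patch l).diam := by positivity
    set s := r / (κ * (M.patch l).diam * d) with hs_def
    have hs : 0 ≤ s := by positivity
    have hs' : s ≤ 1 / 2 := by
      rw [hs_def, div_le_iff₀ (by positivity)]
      have := hr l
      linarith
    obtain ⟨a, b, hab, hsub, hnear⟩ := exists_box_near hξ hs'
    have hsubc := hsub.trans (openCube_subset_cube d)
    refine ⟨(M.patch l).G '' box a b, hG.measurableSet_image ha (isOpen_box a b).measurableSet hsubc,
      image_mono hsub, ?_, ?_⟩
    · rintro _ ⟨η, hη, rfl⟩ ι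
      have h1 := (hG η (hsubc hη) ξ hξ).2
      rw [hξx] at h1
      have h2 : κ * (M.patch l).diam * ‖η - ξ‖ ≤ r := by
        calc κ * (M.patch l).diam * ‖η - ξ‖ ≤ κ * (M.patch l).diam * (d * s) := by
              gcongr; exact hnear η hη
          _ = r := by rw [hs_def]; field_simp
      have h3 := (abs_apply_le_norm _ ι).trans (h1.trans h2)
      rw [PiLp.sub_apply, abs_le] at h3
      exact ⟨by linarith, by linarith⟩
    · have h1 := hG.volume_le ha hsubc
      rw [volume_box] at h1
      simp only [hab, Finset.prod_const, Finset.card_univ, Fintype.card_fin] at h1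
      have h2 : r / (κ ^ 2 * d) = κ⁻¹ * (M.patch l).diam * s := by
        rw [hs_def]; field_simp
      rw [h2, ENNReal.ofReal_pow (by positivity), ENNReal.ofReal_mul ha.le, mul_pow]
      calc _ ≤ ENNReal.ofReal (κ⁻¹ * (M.patch l).diam) ^ d *
            (ENNReal.ofReal (κ⁻¹ * (M.patch l).diam)⁻¹ ^ d *
              volume ((M.patch l).G '' box a b)) := by gcongr
        _ = _ := by
          rw [← mul_assoc, ← mul_pow, ← ENNReal.ofReal_mul ha.le, mul_inv_cancel₀ ha.ne',
            ENNReal.ofReal_one, one_pow, one_mul]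
  choose! A hAm hAd hAb hAv using hbox
  have hdisj : (S : Set (Fin N)).PairwiseDisjoint A := fun k hk l hl hkl =>
    (M.disjoint k l hkl).mono (hAd k hk) (hAd l hl)
  have h1 : (S.card : ENNReal) * ENNReal.ofReal ((r / (κ ^ 2 * d)) ^ d) ≤
      ENNReal.ofReal ((2 * r) ^ d) := by
    calc (S.card : ENNReal) * ENNReal.ofReal ((r / (κ ^ 2 * d)) ^ d)
        = ∑ _l ∈ S, ENNReal.ofReal ((r / (κ ^ 2 * d)) ^ d) := by
          rw [Finset.sum_const, nsmul_eq_mul]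
      _ ≤ ∑ l ∈ S, volume (A l) := Finset.sum_le_sum hAv
      _ = volume (⋃ l ∈ S, A l) := (measure_biUnion_finset hdisj hAm).symm
      _ ≤ volume (closedBox (fun ι => x ι - r) (fun ι => x ι + r)) :=
          measure_mono (iUnion₂_subset hAb)
      _ = ENNReal.ofReal ((2 * r) ^ d) := by
          rw [volume_closedBox, ENNReal.ofReal_pow (by positivity)]
          simp only [add_sub_sub_cancel, ← two_mul, Finset.prod_const, Finset.card_univ,
            Fintype.card_fin]
  rw [← ENNReal.ofReal_natCast, ← ENNReal.ofReal_mul (Nat.cast_nonneg _),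
    ENNReal.ofReal_le_ofReal_iff (by positivity)] at h1
  have h2 : 0 < (r / (κ ^ 2 * d)) ^ d := by positivity
  have h3 : (2 * r) ^ d = (2 * d * κ ^ 2) ^ d * (r / (κ ^ 2 * d)) ^ d := by
    rw [← mul_pow]; congr 1; field_simp
  rw [h3] at h1
  exact le_of_mul_le_mul_right h1 h2

/-- A point of the open patch `k` that lies in the closure of patch `l` would force the two open
patches to meet. -/
lemma interface_subset_boundary (h : ∀ k, (M.patch k).IsShapeRegular κ) {k l : Fin N}
    (hkl : k ≠ l) : M.interface k l ⊆ (M.patch k).boundary := by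
  rintro x ⟨⟨ξ, hξ, rfl⟩, hl⟩
  refine mem_image_of_mem _ (cube_diff_openCube_subset d ⟨hξ, fun hξo => ?_⟩)
  obtain ⟨y, hy, hy'⟩ := mem_closure_iff.1 (Patch.closedDom_subset_closure_dom (h l) hl) _
    (M.patch k).isOpen_dom (mem_image_of_mem _ hξo)
  exact Set.disjoint_left.1 (M.disjoint k l hkl) hy hy'

lemma measurableSet_interface (h : ∀ k, (M.patch k).IsShapeRegular κ) (k l : Fin N) :
    MeasurableSet (M.interface k l) :=
  (Patch.isCompact_closedDom (h k)).measurableSet.inter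
    (Patch.isCompact_closedDom (h l)).measurableSet

lemma ne_of_mem_neighbours {k l : Fin N} (h : l ∈ M.neighbours k) : k ≠ l := by
  classical
  simp only [neighbours, Finset.mem_filter] at h
  exact h.2.1.symm

lemma hAvg_pos [NeZero d] (h : ∀ k, (M.patch k).IsShapeRegular κ) (k l : Fin N) :
    0 < M.hAvg k l := by
  have h1 := Patch.meshSize_pos (h k)
  have h2 := Patch.meshSize_pos (h l)
  unfold hAvg
  positivity

/-- The harmonic average is controlled by the mesh size on one side alone, so no relation between
neighbouring meshes is required. -/
lemma hAvg_le [NeZero d] (h : ∀ k, (M.patch k).IsShapeRegular κ) (k l : Fin N) :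
    M.hAvg k l ≤ 2 * (M.patch k).meshSize := by
  have h1 := Patch.meshSize_pos (h k)
  have h2 := Patch.meshSize_pos (h l)
  unfold hAvg
  rw [div_le_iff₀ (by positivity)]
  nlinarith

/-- The bound includes the default value 0, so the existence of normals plays no role. -/
lemma norm_outerNormal_le (Ω : Set (E d)) (x : E d) : ‖outerNormal Ω x‖ ≤ 1 := by
  unfold outerNormal
  split_ifs with h
  · exact h.choose_spec.1.le
  · simp

lemma abs_normalDeriv_le (K : Patch d) (u : E d → ℝ) (x : E d) :
    |K.normalDeriv u x| ≤ ‖gradientWithin u K.closedDom x‖ := by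
  refine (abs_real_inner_le_norm _ _).trans ?_
  exact mul_le_of_le_one_right (norm_nonneg _) (norm_outerNormal_le _ _)

end Multipatch

/-! ### Bounds for the bilinear forms -/

namespace Multipatch

section Estimates

variable {n N : ℕ} {M : Multipatch (n + 1) N} {κ : ℝ} {u : Fin N → E (n + 1) → ℝ}

lemma aForm_self {d : ℕ} (M : Multipatch d N) (α : Fin N → ℝ) (k : Fin N)
    (u : Fin N → E d → ℝ) :
    M.aForm α k u u = α k * ∫ x in (M.patch k).dom, ‖∇ (u k) x‖ ^ 2 := by
  unfold aForm
  simp only [real_inner_self_eq_norm_sq]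
  rw [integral_const_mul]

lemma pForm_self {d : ℕ} (M : Multipatch d N) (α : Fin N → ℝ) (δ : ℝ) (k : Fin N)
    (u : Fin N → E d → ℝ) :
    M.pForm α δ k u u = ∑ l ∈ M.neighbours k, δ * α k / (2 * M.hAvg k l) *
      ∫ x in M.interface k l, (u l x - u k x) ^ 2 ∂μHE[d - 1] := by
  unfold pForm
  refine Finset.sum_congr rfl fun l _ => ?_
  rw [← integral_const_mul]
  simp only [sq]

lemma integrableOn_jump_sq (hκ : 0 < κ) (h : ∀ k, (M.patch k).IsShapeRegular κ)
    (hu : ∀ k, u k ∈ (M.patch k).space) {k l : Fin N} (hkl : k ≠ l) :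
    IntegrableOn (fun x => (u l x - u k x) ^ 2) (M.interface k l) μHE[n] := by
  obtain ⟨C, hC⟩ := Patch.bounded_of_mem_space (hu k)
  obtain ⟨C', hC'⟩ := Patch.bounded_of_mem_space (hu l)
  refine IntegrableOn.of_bound ((measure_mono (interface_subset_boundary h hkl)).trans_lt
    (Patch.euclideanHausdorffMeasure_boundary_lt_top (h k)))
    (((Patch.aestronglyMeasurable_of_mem_space hκ (h l) (hu l) _).sub
      (Patch.aestronglyMeasurable_of_mem_space hκ (h k) (hu k) _)).pow 2) ((C' + C) ^ 2)
    (.of_forall fun x => ?_)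
  rw [norm_pow]
  gcongr
  exact (abs_sub _ _).trans (add_le_add (hC' x) (hC x))

/-- At each point the number of interfaces counted is at most the number of closed patches through
it. Bounded overlap suffices; that distinct interfaces meet in null sets is not needed. -/
lemma sum_integral_interface_le (hκ : 0 < κ) (h : ∀ k, (M.patch k).IsShapeRegular κ) (k : Fin N)
    {g : E (n + 1) → ℝ} (hg : ∀ x, 0 ≤ g x)
    (hint : IntegrableOn g (M.patch k).boundary μHE[n]) :
    ∑ l ∈ M.neighbours k, ∫ x in M.interface k l, g x ∂μHE[n] ≤
      (2 * (n + 1 : ℕ) * κ ^ 2) ^ (n + 1) * ∫ x in (M.patch k).boundary, g x ∂μHE[n] := by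
  classical
  have hm := fun l => measurableSet_interface h k l
  calc ∑ l ∈ M.neighbours k, ∫ x in M.interface k l, g x ∂μHE[n]
      = ∑ l ∈ M.neighbours k,
          ∫ x in (M.patch k).boundary, (M.interface k l).indicator g x ∂μHE[n] := by
        refine Finset.sum_congr rfl fun l hl => ?_
        rw [setIntegral_indicator (hm l),
          inter_eq_right.2 (interface_subset_boundary h (ne_of_mem_neighbours hl))]
    _ = ∫ x in (M.patch k).boundary,
          ∑ l ∈ M.neighbours k, (M.interface k l).indicator g x ∂μHE[n] :=
        (integral_finsetSum _ fun l _ => hint.integrable.indicator (hm l)).symm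
    _ ≤ ∫ x in (M.patch k).boundary, (2 * (n + 1 : ℕ) * κ ^ 2) ^ (n + 1) * g x ∂μHE[n] := by
        refine integral_mono (integrable_finsetSum _ fun l _ => hint.integrable.indicator (hm l))
          (hint.integrable.const_mul _) fun x => ?_
        have : ∑ l ∈ M.neighbours k, (M.interface k l).indicator g x =
            ((M.neighbours k).filter fun l => x ∈ M.interface k l).card * g x := by
          rw [← nsmul_eq_mul, ← Finset.sum_const, Finset.sum_filter]
          rfl
        show ∑ l ∈ M.neighbours k, (M.interface k l).indicator g x ≤ _
        rw [this]
        refine mul_le_mul_of_nonneg_right (card_closedDom_le (x := x) hκ h _ fun l hl => ?_) (hg x)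
        exact (Finset.mem_filter.1 hl).2.2
    _ = _ := integral_const_mul _ _

lemma aForm_self_nonneg {d : ℕ} (M : Multipatch d N) {α : Fin N → ℝ} (hα : ∀ k, 0 < α k)
    (k : Fin N) (u : Fin N → E d → ℝ) : 0 ≤ M.aForm α k u u := by
  rw [aForm_self]
  exact mul_nonneg (hα k).le (integral_nonneg fun _ => sq_nonneg _)

lemma pForm_self_nonneg (h : ∀ k, (M.patch k).IsShapeRegular κ) {α : Fin N → ℝ}
    (hα : ∀ k, 0 < α k) {δ : ℝ} (hδ : 0 ≤ δ) (k : Fin N) : 0 ≤ M.pForm α δ k u u := by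
  rw [pForm_self]
  refine Finset.sum_nonneg fun l _ => mul_nonneg ?_ (integral_nonneg fun _ => sq_nonneg _)
  have := hAvg_pos h k l
  have := hα k
  positivity

/-- For a sufficiently large penalty parameter, the consistency terms of a patch are dominated by
the energy and the penalty terms. -/
lemma exists_abs_sForm_le (n p : ℕ) {κ θ : ℝ} (hκ : 0 < κ) (hθ : 0 < θ) :
    ∃ δ₀ : ℝ, 0 < δ₀ ∧ ∀ (N : ℕ) (M : Multipatch (n + 1) N),
      (∀ k ι, ((M.patch k).Ξ ι).deg ≤ p) → (∀ k, (M.patch k).IsShapeRegular κ) →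
      (∀ k, (M.patch k).IsQuasiUniform θ) → ∀ α : Fin N → ℝ, (∀ k, 0 < α k) →
      ∀ δ : ℝ, δ₀ ≤ δ → ∀ u : Fin N → E (n + 1) → ℝ, (∀ k, u k ∈ (M.patch k).space) →
      ∀ k, |M.sForm α k u u| ≤ 1 / 2 * M.dForm α δ k u u := by
  obtain ⟨C, hC, HC⟩ := Patch.exists_trace_bound n p hκ hθ
  set m : ℝ := (2 * (n + 1 : ℕ) * κ ^ 2) ^ (n + 1) with hm
  have hm0 : 0 < m := by positivity
  -- This value gives `2 * M.hAvg k l ≤ δ * t`, by which half the penalty dominates the jump terms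
  -- of Young's inequality.
  refine ⟨4 * (m * C), by positivity, fun N M hp h hq α hα δ hδ u hu k => ?_⟩
  obtain ⟨g, hg0, hgint, hg, hgC⟩ := HC (M.patch k) (hp k) (h k) (hq k) (u k) (hu k)
  have hh := Patch.meshSize_pos (h k)
  have hαk := hα k
  -- The Young weight is chosen so that overlap bound and trace inequality turn the gradient terms
  -- into exactly half the energy.
  set t : ℝ := (M.patch k).meshSize / (m * C) with ht
  have ht0 : 0 < t := by positivity
  set J : Fin N → ℝ := fun l => ∫ x in M.interface k l, (u l x - u k x) ^ 2 ∂μHE[n] with hJ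
  have hJ0 : ∀ l, 0 ≤ J l := fun l => integral_nonneg fun _ => sq_nonneg _
  have hterm : ∀ l ∈ M.neighbours k, |∫ x in M.interface k l,
      α k / 2 * ((M.patch k).normalDeriv (u k) x * (u l x - u k x)
        + (M.patch k).normalDeriv (u k) x * (u l x - u k x)) ∂μHE[n]| ≤
      α k * (t / 2) * (∫ x in M.interface k l, g x ∂μHE[n]) + α k / (2 * t) * J l := by
    intro l hl
    have hkl := ne_of_mem_neighbours hl
    have hsub := interface_subset_boundary h hkl
    have hi1 : IntegrableOn g (M.interface k l) μHE[n] := hgint.mono_set hsub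
    have hi2 := integrableOn_jump_sq hκ h hu hkl
    have hae := ae_mono (Measure.restrict_mono hsub (le_refl μHE[n])) hg
    rw [hJ, ← integral_const_mul, ← integral_const_mul,
      ← integral_add (hi1.integrable.const_mul _) (hi2.integrable.const_mul _)]
    rw [← Real.norm_eq_abs]
    refine norm_integral_le_of_norm_le
      ((hi1.integrable.const_mul _).add (hi2.integrable.const_mul _)) ?_
    filter_upwards [hae] with x hx
    have h1 := abs_normalDeriv_le (M.patch k) (u k) x
    set D := (M.patch k).normalDeriv (u k) x
    have h2 : D ^ 2 ≤ g x := by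
      rw [← sq_abs]
      exact (pow_le_pow_left₀ (abs_nonneg _) h1 2).trans hx
    have h3 : |D * (u l x - u k x)| ≤ t / 2 * g x + 1 / (2 * t) * (u l x - u k x) ^ 2 := by
      set y := u l x - u k x
      have h4 : |D * y| ≤ t / 2 * D ^ 2 + 1 / (2 * t) * y ^ 2 := by
        have h5 : t / 2 * D ^ 2 + 1 / (2 * t) * y ^ 2 = (t ^ 2 * D ^ 2 + y ^ 2) / (2 * t) := by
          field_simp
        rw [h5, le_div_iff₀ (by positivity), abs_mul]
        nlinarith [sq_nonneg (t * |D| - |y|), sq_abs D, sq_abs y]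
      have : t / 2 * D ^ 2 ≤ t / 2 * g x := by gcongr
      linarith
    calc ‖α k / 2 * (D * (u l x - u k x) + D * (u l x - u k x))‖
        = α k * |D * (u l x - u k x)| := by
          rw [← two_mul, ← mul_assoc, div_mul_cancel₀ _ two_ne_zero, Real.norm_eq_abs, abs_mul,
            abs_of_pos hαk]
      _ ≤ α k * (t / 2 * g x + 1 / (2 * t) * (u l x - u k x) ^ 2) := by gcongr
      _ = _ := by ring
  have hgsum := sum_integral_interface_le hκ h k hg0 hgint
  rw [← hm] at hgsum
  have h1 : α k * (t / 2) * ∑ l ∈ M.neighbours k, ∫ x in M.interface k l, g x ∂μHE[n] ≤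
      1 / 2 * M.aForm α k u u := by
    rw [aForm_self]
    calc _ ≤ α k * (t / 2) * (m * ∫ x in (M.patch k).boundary, g x ∂μHE[n]) := by gcongr
      _ = α k / (2 * C) * ((M.patch k).meshSize * ∫ x in (M.patch k).boundary, g x ∂μHE[n]) := by
        rw [ht]; field_simp
      _ ≤ α k / (2 * C) * (C * ∫ x in (M.patch k).dom, ‖∇ (u k) x‖ ^ 2) := by gcongr
      _ = _ := by field_simp
  have h2 : ∑ l ∈ M.neighbours k, α k / (2 * t) * J l ≤ 1 / 2 * M.pForm α δ k u u := by
    rw [pForm_self, Finset.mul_sum]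
    refine Finset.sum_le_sum fun l _ => ?_
    rw [← mul_assoc]
    refine mul_le_mul_of_nonneg_right ?_ (hJ0 l)
    have h3 := hAvg_pos h k l
    have h4 := hAvg_le h k l
    have h5 : 2 * M.hAvg k l ≤ δ * t := by
      calc 2 * M.hAvg k l ≤ 4 * (M.patch k).meshSize := by linarith
        _ = 4 * (m * C) * t := by rw [ht]; field_simp
        _ ≤ δ * t := by gcongr
    have h6 : 1 / 2 * (δ * α k / (2 * M.hAvg k l)) = α k * δ / (2 * (2 * M.hAvg k l)) := by
      field_simp
    rw [h6, div_le_div_iff₀ (by positivity) (by positivity)]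
    nlinarith
  calc |M.sForm α k u u| ≤ ∑ l ∈ M.neighbours k, (α k * (t / 2) *
        (∫ x in M.interface k l, g x ∂μHE[n]) + α k / (2 * t) * J l) :=
        (Finset.abs_sum_le_sum_abs _ _).trans (Finset.sum_le_sum hterm)
    _ ≤ 1 / 2 * M.aForm α k u u + 1 / 2 * M.pForm α δ k u u := by
        rw [Finset.sum_add_distrib, ← Finset.mul_sum]
        exact add_le_add h1 h2
    _ = _ := by rw [dForm]; ring

/-- The 2 compensates the factor 1/2 in the penalty weight of `pForm`, which the dG norm lacks. -/
lemma dgNormSq_eq {d : ℕ} (M : Multipatch d N) (α : Fin N → ℝ) (δ : ℝ) (u : Fin N → E d → ℝ) :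
    M.dgNormSq α δ u = ∑ k, (M.aForm α k u u + 2 * M.pForm α δ k u u) := by
  unfold dgNormSq
  refine Finset.sum_congr rfl fun k _ => ?_
  rw [aForm_self, pForm_self, Finset.mul_sum]
  congr 1
  refine Finset.sum_congr rfl fun l _ => ?_
  simp only [sub_sq_comm (u k _)]
  rw [← mul_assoc]
  congr 1
  rw [mul_div_assoc', mul_div_mul_left _ _ two_ne_zero]

end Estimates

end Multipatch

end IgA

theorem lemma1 (d : ℕ) (hd : d = 2 ∨ d = 3) (p : ℕ) (κ θ : ℝ) (hκ : 1 ≤ κ) (hθ : 1 ≤ θ) :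
    ∃ δ₀ γ₀ γ₁ : ℝ, 0 < δ₀ ∧ 0 < γ₀ ∧ 0 < γ₁ ∧
      ∀ (N : ℕ) (M : IgA.Multipatch d N),
        (∀ k ι, ((M.patch k).Ξ ι).deg ≤ p) →
        (∀ k, (M.patch k).IsShapeRegular κ) →
        (∀ k, (M.patch k).IsQuasiUniform θ) →
        ∀ α : Fin N → ℝ, (∀ k, 0 < α k) →
        ∀ δ : ℝ, δ₀ ≤ δ →
        ∀ u ∈ M.space,
          (∀ k, γ₀ * M.dForm α δ k u u ≤ M.aeForm α δ k u u ∧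
            M.aeForm α δ k u u ≤ γ₁ * M.dForm α δ k u u) ∧
          (∀ k, γ₀ * (M.aeForm α δ k u u + M.pForm α δ k u u) ≤ M.aeForm α δ k u u ∧
            M.aeForm α δ k u u ≤ γ₁ * (M.aeForm α δ k u u + M.pForm α δ k u u)) ∧
          (γ₀ * M.dgNormSq α δ u ≤ M.ahForm α δ u u ∧
            M.ahForm α δ u u ≤ γ₁ * M.dgNormSq α δ u) := by
  obtain ⟨n, rfl⟩ : ∃ n, d = n + 1 := ⟨d - 1, by omega⟩
  obtain ⟨δ₀, hδ₀, H⟩ := IgA.Multipatch.exists_abs_sForm_le n p (by linarith : 0 < κ)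
    (by linarith : 0 < θ)
  -- From |s| ≤ (a + p)/2 one gets (a + p)/2 ≤ a_e ≤ 3(a + p)/2, hence p ≤ 2 a_e and a_e + p ≤ 3
  -- a_e. The dG norm needs the smaller constant 1/4, because a + 2p ≤ 2(a + p) ≤ 4 a_e.
  refine ⟨δ₀, 1 / 4, 3 / 2, hδ₀, by norm_num, by norm_num, fun N M hp h hq α hα δ hδ u hu => ?_⟩
  have hs := fun k => abs_le.1 (H N M hp h hq α hα δ hδ u hu.1 k)
  have ha := fun k => M.aForm_self_nonneg hα k u
  have hpn := fun k => IgA.Multipatch.pForm_self_nonneg (u := u) h hα (hδ₀.le.trans hδ) k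
  simp only [IgA.Multipatch.dForm] at hs
  simp only [IgA.Multipatch.aeForm, IgA.Multipatch.dForm, IgA.Multipatch.ahForm,
    IgA.Multipatch.dgNormSq_eq, Finset.mul_sum]
  refine ⟨fun k => ⟨?_, ?_⟩, fun k => ⟨?_, ?_⟩, Finset.sum_le_sum fun k _ => ?_,
    Finset.sum_le_sum fun k _ => ?_⟩ <;>
  linarith [hs k, (hs k).1, (hs k).2, ha k, hpn k]
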